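/- Points in the plane are coloured red or blue. Let $S$ be a finite set of $n$ such points, no two of which share an $x$-coordinate or a $y$-coordinate. Two points $p,q\in S$ *see each other* in $S$ if the axis-aligned box spanned by $p$ and $q$ contains no point of $S$ in its interior; $p\in S$ *participates* in $S$ if it sees some point of $S$ of the opposite colour. **Entropy.** For an axis-aligned box $B=[x_{\min},x_{\max}]\times[y_{\min},y_{\max}]$ let $\mathrm{cross}(B)$ be the set of points $p$ with $x_{\min}\le x(p)\le x_{\max}$ or $y_{\min}\le y(p)\le y_{\max}$; the four components of its complement are the quadrants $\mathrm{NE}(B),\mathrm{NW}(B),\mathrm{SE}(B),\mathrm{SW}(B)$. The NE-minimal set of a point set $A$ consists of the $p\in A$ for which there is no $q\in A\setminus\{p\}$ with $x(q)\le x(p)$ and $y(q)\le y(p)$; the NW-, SE- and SW-minimal sets are its mirror images (under $x\mapsto -x$, under $y\mapsto -y$, and under both). The box $B$ is *red-safe* for $S$ if all points of $S\cap\mathrm{cross}(B)$ are red and, for each $Q\in\{\mathrm{NE},\mathrm{NW},\mathrm{SE},\mathrm{SW}\}$, all points of the $Q$-minimal set of $S\cap Q(B)$ are red; *blue-safe*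 is defined in the same way, and *safe* means red-safe or blue-safe. A subset of $S$ is *safe* if it is contained in a box that is safe for $S$. A partition $\Pi$ of $S$ into nonempty parts is *respectful* if each of its parts is a singleton or a safe subset of $S$. The *structural entropy* $\mathcal H(S)$ is the minimum, over all respectful partitions $\Pi$ of $S$, of $\sum_{S_k\in\Pi}\frac{|S_k|}{n}\log_2\frac{n}{|S_k|}$. **Model.** The input is a sequence of $n$ coloured points with pairwise distinct $x$-coordinates and pairwise distinct $y$-coordinates. An algorithm is a binary decision tree whose inner nodes compare the $x$-coordinates, or the $y$-coordinates, of the points at two indices, or look up the colour of the point at an index, and whose leaves report a set of indices (or of pairs of indices). It is correct for a problem if it reports exactly the required set on every such sequence. Its cost on an input is the number of comparisons made plus the number of items reported; in the model with *charged colours*, every colour look-up also costs one unit, while in the model with *free colours* it costs nothing. Let $\mathrm{OPT}(S)$ be the minimum, over all correct decision trees $A$, of the maximum of the cost of $A$ over all $n!$ orderings of $S$. **Theorem.** There is an absolute constant $c>0$ such that, for every $S$ as above: 1. for the problem of reporting all participating points, $\mathrm{OPT}(S)\ge c\,n(\mathcal H(S)+1)$; 2. for the problem of reporting all pairs (red point,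 blue point) of points of $S$ that see each other, $\mathrm{OPT}(S)\ge c\,\bigl(n(\mathcal H(S)+1)+h\bigr)$, where $h$ is the number of these pairs. Both bounds hold in the model with free colours whenever $S$ contains points of both colours, and in the model with charged colours whenever $n\ge 2$. -/

import Mathlib

namespace RedBlue

/-! ### Coloured points, visibility, participation -/

inductive Color where
  | red
  | blue

/-- A point of the plane, coloured red or blue. -/
structure CPoint where
  x : ℝ
  y : ℝ
  color : Color

noncomputable instance : DecidableEq CPoint := Classical.decEq _

/-- No two points of `S` share an `x` or a `y` coordinate. -/
def NonDegenerate (S : Finset CPoint) : Prop :=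
  Set.InjOn CPoint.x (S : Set CPoint) ∧ Set.InjOn CPoint.y (S : Set CPoint)

/-- Both colours occur in `S`. -/
def Bichromatic (S : Finset CPoint) : Prop :=
  (∃ p ∈ S, p.color = Color.red) ∧ ∃ p ∈ S, p.color = Color.blue

/-- `r` lies in the interior of the axis-aligned box spanned by `p` and `q`. -/
def InSpannedInterior (p q r : CPoint) : Prop :=
  min p.x q.x < r.x ∧ r.x < max p.x q.x ∧ min p.y q.y < r.y ∧ r.y < max p.y q.y

/-- `p` and `q` see each other in `S`. -/
def Visible (S : Finset CPoint) (p q : CPoint) : Prop :=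
  ∀ r ∈ S, ¬ InSpannedInterior p q r

/-- `p` participates in `S`: it is visible from a point of `S` of the opposite colour. -/
def Participates (S : Finset CPoint) (p : CPoint) : Prop :=
  p ∈ S ∧ ∃ q ∈ S, q.color ≠ p.color ∧ Visible S p q

open Classical in
/-- The pairs (red point, blue point) of `S` which see each other in `S`. -/
noncomputable def visiblePairs (S : Finset CPoint) : Finset (CPoint × CPoint) :=
  (S ×ˢ S).filter fun pq =>
    pq.1.color = Color.red ∧ pq.2.color = Color.blue ∧ Visible S pq.1 pq.2

/-! ### Boxes and safety -/

/-- A closed axis-aligned box `[xmin, xmax] × [ymin, ymax]`. -/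
structure Box where
  xmin : ℝ
  xmax : ℝ
  ymin : ℝ
  ymax : ℝ
  x_le : xmin ≤ xmax
  y_le : ymin ≤ ymax

namespace Box

def region (B : Box) : Set CPoint :=
  {p | (B.xmin ≤ p.x ∧ p.x ≤ B.xmax) ∧ (B.ymin ≤ p.y ∧ p.y ≤ B.ymax)}

def cross (B : Box) : Set CPoint :=
  {p | (B.xmin ≤ p.x ∧ p.x ≤ B.xmax) ∨ (B.ymin ≤ p.y ∧ p.y ≤ B.ymax)}

/-! The four quadrants of a box: the components of the complement of its cross. -/

def NE (B : Box) : Set CPoint := {p | B.xmax < p.x ∧ B.ymax < p.y}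

def NW (B : Box) : Set CPoint := {p | p.x < B.xmin ∧ B.ymax < p.y}

def SE (B : Box) : Set CPoint := {p | B.xmax < p.x ∧ p.y < B.ymin}

def SW (B : Box) : Set CPoint := {p | p.x < B.xmin ∧ p.y < B.ymin}

end Box

/-- Points of `A` which dominate no other point of `A`. -/
def neMinimal (A : Set CPoint) : Set CPoint :=
  {p | p ∈ A ∧ ∀ q ∈ A, q ≠ p → ¬ (q.x ≤ p.x ∧ q.y ≤ p.y)}

/-- The mirror image of `neMinimal` under `x ↦ -x`. -/
def nwMinimal (A : Set CPoint) : Set CPoint :=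
  {p | p ∈ A ∧ ∀ q ∈ A, q ≠ p → ¬ (p.x ≤ q.x ∧ q.y ≤ p.y)}

/-- The mirror image of `neMinimal` under `y ↦ -y`. -/
def seMinimal (A : Set CPoint) : Set CPoint :=
  {p | p ∈ A ∧ ∀ q ∈ A, q ≠ p → ¬ (q.x ≤ p.x ∧ p.y ≤ q.y)}

/-- The mirror image of `neMinimal` under both reflections. -/
def swMinimal (A : Set CPoint) : Set CPoint :=
  {p | p ∈ A ∧ ∀ q ∈ A, q ≠ p → ¬ (p.x ≤ q.x ∧ p.y ≤ q.y)}

/-- All points of `A` have colour `c`. -/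
def AllColor (c : Color) (A : Set CPoint) : Prop := ∀ p ∈ A, p.color = c

/-- `B` is `c`-cross-safe for `S`. -/
def Box.CrossSafe (B : Box) (S : Finset CPoint) (c : Color) : Prop :=
  AllColor c ((S : Set CPoint) ∩ B.cross)

/-- `B` is `c`-safe for `S` (red-safe or blue-safe, according to `c`). -/
def Box.SafeOfColor (B : Box) (S : Finset CPoint) (c : Color) : Prop :=
  B.CrossSafe S c ∧
    AllColor c (neMinimal ((S : Set CPoint) ∩ B.NE)) ∧
    AllColor c (nwMinimal ((S : Set CPoint) ∩ B.NW)) ∧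
    AllColor c (seMinimal ((S : Set CPoint) ∩ B.SE)) ∧
    AllColor c (swMinimal ((S : Set CPoint) ∩ B.SW))

def Box.Safe (B : Box) (S : Finset CPoint) : Prop :=
  B.SafeOfColor S Color.red ∨ B.SafeOfColor S Color.blue

/-- `S'` is a safe subset of `S`: it can be enclosed by a box which is safe for `S`. -/
def SafeSubset (S' S : Finset CPoint) : Prop :=
  S' ⊆ S ∧ ∃ B : Box, (S' : Set CPoint) ⊆ B.region ∧ B.Safe S

/-! ### Structural entropy -/

/-- Every part is a singleton or a safe subset of `S`. -/
def Respectful {S : Finset CPoint} (P : Finpartition S) : Prop :=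
  ∀ A ∈ P.parts, A.card = 1 ∨ SafeSubset A S

noncomputable def entropy {S : Finset CPoint} (P : Finpartition S) : ℝ :=
  ∑ A ∈ P.parts, ((A.card : ℝ) / S.card) * Real.logb 2 ((S.card : ℝ) / A.card)

/-- The minimum of the entropy over the respectful partitions of `S`. There are finitely many
partitions, and the partition into singletons is respectful. -/
noncomputable def structuralEntropy (S : Finset CPoint) : ℝ :=
  sInf {t : ℝ | ∃ P : Finpartition S, Respectful P ∧ t = entropy P}

/-! ### Comparison-based decision trees -/

/-- The queries that can be asked about an input sequence of `n` coloured points. -/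
inductive Query (n : ℕ) where
  | ltX (i j : Fin n)
  | ltY (i j : Fin n)
  | isRed (i : Fin n)

def Query.Holds {n : ℕ} (I : Fin n → CPoint) : Query n → Prop
  | .ltX i j => (I i).x < (I j).x
  | .ltY i j => (I i).y < (I j).y
  | .isRed i => (I i).color = Color.red

/-- The price of a query: a comparison costs `1`, looking up a colour costs `κ`. -/
def Query.price {n : ℕ} (κ : ℕ) : Query n → ℕ
  | .ltX _ _ => 1
  | .ltY _ _ => 1
  | .isRed _ => κ

/-- Decision trees on `n` input points, reporting at each leaf a finite set of items. -/
inductive DecisionTree (n : ℕ) (α : Type) where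
  | report (out : Finset α)
  | branch (q : Query n) (yes no : DecisionTree n α)

namespace DecisionTree

variable {n : ℕ} {α : Type}

open Classical in
/-- What the tree reports on the input `I`. -/
noncomputable def output (I : Fin n → CPoint) : DecisionTree n α → Finset α
  | report out => out
  | branch q yes no => if q.Holds I then yes.output I else no.output I

open Classical in
/-- The running time of the tree on the input `I`: the price of the queries asked, plus one unit
for every item reported. -/
noncomputable def time (κ : ℕ) (I : Fin n → CPoint) : DecisionTree n α → ℕ
  | report out => out.card
  | branch q yes no => q.price κ + if q.Holds I then yes.time κ I else no.time κ I

end DecisionTree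

/-- An input sequence is admissible if no two entries share an `x` or a `y` coordinate. -/
def IsInstance {n : ℕ} (I : Fin n → CPoint) : Prop :=
  Function.Injective (fun i => (I i).x) ∧ Function.Injective (fun i => (I i).y)

/-- The set of the points of an input sequence. -/
noncomputable def pointSet {n : ℕ} (I : Fin n → CPoint) : Finset CPoint :=
  Finset.univ.image I

/-- A reporting problem on `n` points: the set of items to be reported on each input. -/
abbrev Problem (n : ℕ) (α : Type) := (Fin n → CPoint) → Finset α

open Classical in
/-- Report (the indices of) all participating points. -/
noncomputable def participatingProblem (n : ℕ) : Problem n (Fin n) := fun I =>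
  Finset.univ.filter fun i => Participates (pointSet I) (I i)

open Classical in
/-- Report (the indices of) all pairs (red point, blue point) which see each other. -/
noncomputable def pairsProblem (n : ℕ) : Problem n (Fin n × Fin n) := fun I =>
  Finset.univ.filter fun ij =>
    (I ij.1).color = Color.red ∧ (I ij.2).color = Color.blue ∧
      Visible (pointSet I) (I ij.1) (I ij.2)

/-- The tree answers correctly on every admissible input sequence. -/
def Correct {n : ℕ} {α : Type} (F : Problem n α) (A : DecisionTree n α) : Prop :=
  ∀ I : Fin n → CPoint, IsInstance I → A.output I = F I

/-- The order-oblivious running time of `A` on `S`: the maximum over all orderings of `S`. -/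
noncomputable def worstTime {α : Type} (κ : ℕ) (S : Finset CPoint)
    (A : DecisionTree S.card α) : ℕ :=
  (Finset.univ : Finset (Fin S.card ≃ {p // p ∈ S})).sup
    fun σ => A.time κ fun i => (σ i : CPoint)

/-- The minimum order-oblivious running time on `S` over all correct decision trees
(there is one, see `exists_correct_participating` and `exists_correct_pairs`). -/
noncomputable def OPT {α : Type} (κ : ℕ) (S : Finset CPoint) (F : Problem S.card α) : ℕ :=
  sInf {t : ℕ | ∃ A : DecisionTree S.card α, Correct F A ∧ t = worstTime κ S A}

/-- `OPT` for reporting participating points. -/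
noncomputable def optParticipating (κ : ℕ) (S : Finset CPoint) : ℕ :=
  OPT κ S (participatingProblem S.card)

/-- `OPT` for reporting red-blue pairs of visible points. -/
noncomputable def optPairs (κ : ℕ) (S : Finset CPoint) : ℕ :=
  OPT κ S (pairsProblem S.card)

/-! ### Correct decision trees exist -/

/-- A problem is solved by some tree if the answers to all queries determine its solution. -/
theorem exists_correct {n : ℕ} {α : Type} (F : Problem n α)
    (hF : ∀ I J : Fin n → CPoint, IsInstance I → IsInstance J →
      (∀ q : Query n, q.Holds I ↔ q.Holds J) → F I = F J) :
    ∃ A : DecisionTree n α, Correct F A := by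
  classical
  have key : ∀ (L : List (Query n)) (K : (Fin n → CPoint) → Prop),
      (∀ I J : Fin n → CPoint, IsInstance I → IsInstance J → K I → K J →
        (∀ q ∈ L, q.Holds I ↔ q.Holds J) → F I = F J) →
      ∃ A : DecisionTree n α, ∀ I, IsInstance I → K I → A.output I = F I := by
    intro L
    induction L with
    | nil =>
      intro K hK
      by_cases h : ∃ J, IsInstance J ∧ K J
      · obtain ⟨J, hJ, hKJ⟩ := h
        exact ⟨.report (F J), fun I hI hKI => hK J I hJ hI hKJ hKI (by simp)⟩
      · exact ⟨.report ∅, fun I hI hKI => absurd ⟨I, hI, hKI⟩ h⟩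
    | cons q L ih =>
      intro K hK
      obtain ⟨A, hA⟩ := ih (fun I => K I ∧ q.Holds I) (by
        intro I J hI hJ h1 h2 h
        refine hK I J hI hJ h1.1 h2.1 ?_
        intro r hr
        rcases List.mem_cons.1 hr with rfl | hr
        · exact iff_of_true h1.2 h2.2
        · exact h r hr)
      obtain ⟨A', hA'⟩ := ih (fun I => K I ∧ ¬ q.Holds I) (by
        intro I J hI hJ h1 h2 h
        refine hK I J hI hJ h1.1 h2.1 ?_
        intro r hr
        rcases List.mem_cons.1 hr with rfl | hr
        · exact iff_of_false h1.2 h2.2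
        · exact h r hr)
      refine ⟨.branch q A A', fun I hI hKI => ?_⟩
      by_cases h : q.Holds I
      · simp only [DecisionTree.output, if_pos h]
        exact hA I hI ⟨hKI, h⟩
      · simp only [DecisionTree.output, if_neg h]
        exact hA' I hI ⟨hKI, h⟩
  let L : List (Query n) :=
    (List.finRange n).flatMap (fun i => (List.finRange n).map (Query.ltX i)) ++
    ((List.finRange n).flatMap (fun i => (List.finRange n).map (Query.ltY i)) ++
      (List.finRange n).map Query.isRed)
  have hL : ∀ q : Query n, q ∈ L := by
    intro q
    cases q <;> simp [L]
  obtain ⟨A, hA⟩ := key L (fun _ => True)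
    (fun I J hI hJ _ _ h => hF I J hI hJ fun q => h q (hL q))
  exact ⟨A, fun I hI => hA I hI trivial⟩

theorem visible_congr {n : ℕ} {I J : Fin n → CPoint}
    (h : ∀ q : Query n, q.Holds I ↔ q.Holds J) (i j : Fin n) :
    Visible (pointSet I) (I i) (I j) ↔ Visible (pointSet J) (J i) (J j) := by
  have hx : ∀ a b, (I a).x < (I b).x ↔ (J a).x < (J b).x := fun a b => h (.ltX a b)
  have hy : ∀ a b, (I a).y < (I b).y ↔ (J a).y < (J b).y := fun a b => h (.ltY a b)
  simp only [Visible, pointSet, InSpannedInterior, Finset.forall_mem_image, Finset.mem_univ,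
    true_imp_iff, min_lt_iff, lt_max_iff, hx, hy]

theorem color_congr {n : ℕ} {I J : Fin n → CPoint}
    (h : ∀ q : Query n, q.Holds I ↔ q.Holds J) (i : Fin n) : (I i).color = (J i).color := by
  have hc : (I i).color = Color.red ↔ (J i).color = Color.red := h (.isRed i)
  cases h1 : (I i).color <;> cases h2 : (J i).color <;> simp_all

theorem exists_correct_participating (n : ℕ) :
    ∃ A : DecisionTree n (Fin n), Correct (participatingProblem n) A := by
  refine exists_correct _ fun I J _ _ h => ?_
  ext i
  have hP : Participates (pointSet I) (I i) ↔ Participates (pointSet J) (J i) := by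
    have hv := fun j => visible_congr h i j
    have hc := color_congr h
    unfold Participates
    simp only [pointSet] at hv ⊢
    simp [hc, hv]
  simp [participatingProblem, hP]

theorem exists_correct_pairs (n : ℕ) :
    ∃ A : DecisionTree n (Fin n × Fin n), Correct (pairsProblem n) A := by
  refine exists_correct _ fun I J _ _ h => ?_
  ext i
  simp [pairsProblem, color_congr h, visible_congr h]

end RedBlue

namespace RedBlue
open scoped Classical

/-! ### Gaps and medians in finite sets of reals -/

/-! The proof is an adversary argument. Each colour class is subdivided recursively at the medians
of both coordinates into four cells, stopping at cells with at most one point and at safe subsets of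
`S`. The nonempty leaves form a respectful partition. A four-way split costs at most two bits per
point and the split into colours at most one, so `n * H(S)` is at most `n` plus twice the total size
of the inner cells (`card_mul_structuralEntropy_le`). It remains to bound this total size by the
running time.

The adversary keeps every index in a cell, together with an ordering of `S` compatible with these
cells. A comparison is answered by moving each of the two indices one level down, to the convenient
side of its median (`exists_decides`). This is possible while that side has room. Once it is full,
at least half of the cell has been passed through, and further moves out of that cell are free.
Accordingly `paid` sums over the inner cells the number of indices that have passed, capped at half
the size of the cell, and it grows by at most two per comparison.

When the tree stops, its answer is the same for all inputs that agree with the commitment. An index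
in an inner cell can be made to participate, because the bounding box of the cell is not safe
(`exists_participates`). If four other indices share the cell, they can instead be placed around it
to hide it (`exists_not_participates`). Hence at most four indices stay at each inner cell. Since
cell sizes decay geometrically, the staying indices account for only a linear part of the total size
(`nodeSum_card_le`), and the rest has been paid for up to a factor of two (`nodeSum_card_le_paid`).

The remaining linear term is bounded by `n ≤ 2 * time`: a point that is neither compared nor
reported could be moved to where it participates. In a monochromatic set the entropy term vanishes,
and charged colours force every colour to be looked up. Reporting pairs costs at least `h` merely to
write down. -/

theorem exists_gap_right (Y : Finset ℝ) {U : Set ℝ} (hU : IsOpen U) {a : ℝ} (ha : a ∈ U) :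
    ∃ t ∈ U, a < t ∧ ∀ y ∈ Y, y ≤ a ∨ t < y := by
  have h1 : ∀ᶠ t in nhdsWithin a (Set.Ioi a), t ∈ U :=
    nhdsWithin_le_nhds (hU.mem_nhds ha)
  have h2 : ∀ᶠ t in nhdsWithin a (Set.Ioi a), ∀ y ∈ Y, y ≤ a ∨ t < y := by
    rw [Filter.eventually_all_finset]
    intro y _
    rcases le_or_gt y a with h | h
    · exact Filter.Eventually.of_forall fun _ => Or.inl h
    · exact Filter.Eventually.mono (nhdsWithin_le_nhds (Iio_mem_nhds h)) fun _ ht => Or.inr ht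
  obtain ⟨t, ⟨h3, h4⟩, h5⟩ := ((h1.and h2).and self_mem_nhdsWithin).exists
  exact ⟨t, h3, h5, h4⟩

theorem exists_gap_left (Y : Finset ℝ) {U : Set ℝ} (hU : IsOpen U) {a : ℝ} (ha : a ∈ U) :
    ∃ t ∈ U, t < a ∧ ∀ y ∈ Y, a ≤ y ∨ y < t := by
  have h1 : ∀ᶠ t in nhdsWithin a (Set.Iio a), t ∈ U :=
    nhdsWithin_le_nhds (hU.mem_nhds ha)
  have h2 : ∀ᶠ t in nhdsWithin a (Set.Iio a), ∀ y ∈ Y, a ≤ y ∨ y < t := by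
    rw [Filter.eventually_all_finset]
    intro y _
    rcases le_or_gt a y with h | h
    · exact Filter.Eventually.of_forall fun _ => Or.inl h
    · exact Filter.Eventually.mono (nhdsWithin_le_nhds (Ioi_mem_nhds h)) fun _ ht => Or.inr ht
  obtain ⟨t, ⟨h3, h4⟩, h5⟩ := ((h1.and h2).and self_mem_nhdsWithin).exists
  exact ⟨t, h3, h5, h4⟩

/-- The threshold for `k + 1` is placed just to the right of the least value above the threshold for
`k`. -/
theorem exists_cut {ι : Type*} (f : ι → ℝ) (X : Finset ι) (hf : Set.InjOn f X) (k : ℕ)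
    (hk : k ≤ X.card) :
    ∃ t, (∀ p ∈ X, f p ≠ t) ∧ (X.filter fun p => f p < t).card = k := by
  induction k with
  | zero =>
    obtain ⟨t, -, ht⟩ : ∃ t, t ∈ (Set.univ : Set ℝ) ∧ ∀ y ∈ X.image f, t < y := by
      have : ∀ᶠ t in Filter.atBot, ∀ y ∈ X.image f, t < y := by
        rw [Filter.eventually_all_finset]
        exact fun y _ => Filter.eventually_lt_atBot y
      obtain ⟨t, ht⟩ := this.exists
      exact ⟨t, trivial, ht⟩
    have ht' : ∀ p ∈ X, t < f p := fun p hp => ht _ (Finset.mem_image_of_mem f hp)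
    refine ⟨t, fun p hp => (ht' p hp).ne', ?_⟩
    rw [Finset.card_eq_zero, Finset.filter_eq_empty_iff]
    exact fun p hp => (ht' p hp).le.not_gt
  | succ k ih =>
    obtain ⟨t, h1, h2⟩ := ih (by omega)
    have hne : (X.filter fun p => t < f p).Nonempty := by
      by_contra h
      rw [Finset.not_nonempty_iff_eq_empty, Finset.filter_eq_empty_iff] at h
      have : X.filter (fun p => f p < t) = X :=
        Finset.filter_true_of_mem fun p hp => lt_of_le_of_ne (not_lt.1 (h hp)) (h1 p hp)
      rw [this] at h2
      omega
    obtain ⟨m, hm, hmin⟩ := Finset.exists_min_image _ f hne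
    rw [Finset.mem_filter] at hm
    obtain ⟨t', -, h3, h4⟩ := exists_gap_right (X.image f) isOpen_univ (Set.mem_univ (f m))
    have h4' : ∀ p ∈ X, f p ≤ f m ∨ t' < f p := fun p hp => h4 _ (Finset.mem_image_of_mem f hp)
    refine ⟨t', fun p hp => ?_, ?_⟩
    · rcases h4' p hp with h | h
      · exact (h.trans_lt h3).ne
      · exact h.ne'
    · have : X.filter (fun p => f p < t') = insert m (X.filter fun p => f p < t) := by
        ext p
        simp only [Finset.mem_filter, Finset.mem_insert]
        constructor
        · rintro ⟨hp, hlt⟩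
          rcases lt_or_ge (f p) t with h | h
          · exact Or.inr ⟨hp, h⟩
          · have h5 := hmin p (Finset.mem_filter.2 ⟨hp, lt_of_le_of_ne h (h1 p hp).symm⟩)
            rcases h4' p hp with h6 | h6
            · exact Or.inl (hf hp hm.1 (le_antisymm h6 h5))
            · exact absurd hlt h6.le.not_gt
        · rintro (rfl | ⟨hp, hlt⟩)
          · exact ⟨hm.1, h3⟩
          · exact ⟨hp, hlt.trans (hm.2.trans h3)⟩
      rw [this, Finset.card_insert_of_notMem, h2]
      simp only [Finset.mem_filter, not_and, not_lt]
      exact fun _ => hm.2.le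

/-- `a` lies strictly above (`b = true`) or strictly below (`b = false`) the threshold `t`. -/
def OnSide (b : Bool) (a t : ℝ) : Prop := if b then t < a else a < t

theorem OnSide.unique {b b' : Bool} {a t : ℝ} (h : OnSide b a t) (h' : OnSide b' a t) :
    b = b' := by
  cases b <;> cases b' <;> simp [OnSide] at h h' ⊢ <;> exact (lt_asymm h h')

theorem exists_onSide {a t : ℝ} (h : a ≠ t) : ∃ b, OnSide b a t := by
  rcases lt_or_gt_of_ne h with h | h
  · exact ⟨false, by simpa [OnSide] using h⟩
  · exact ⟨true, by simpa [OnSide] using h⟩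

theorem isOpen_onSide (b : Bool) (t : ℝ) : IsOpen {a | OnSide b a t} := by
  cases b
  · exact isOpen_gt' t
  · exact isOpen_lt' t

theorem ordConnected_onSide (b : Bool) (t : ℝ) : Set.OrdConnected {a | OnSide b a t} := by
  refine ⟨fun x hx y hy z hz => ?_⟩
  cases b
  · exact lt_of_le_of_lt hz.2 hy
  · exact lt_of_lt_of_le hx hz.1

/-- The coordinates of a point: `x` for `true` and `y` for `false`. -/
def coord (a : Bool) (p : CPoint) : ℝ := if a then p.x else p.y

/-- `t` halves `X` with respect to the coordinate `a` and avoids the coordinates of `X`. -/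
def IsMedian (a : Bool) (X : Finset CPoint) (t : ℝ) : Prop :=
  (∀ p ∈ X, coord a p ≠ t) ∧ ∀ b, X.card / 2 ≤ (X.filter fun p => OnSide b (coord a p) t).card

theorem exists_isMedian {X : Finset CPoint} {a : Bool} (hX : Set.InjOn (coord a) X) :
    ∃ t, IsMedian a X t := by
  obtain ⟨t, h1, h2⟩ := exists_cut (coord a) X hX (X.card / 2) (Nat.div_le_self _ _)
  refine ⟨t, h1, fun b => ?_⟩
  cases b
  · simp [OnSide, h2]
  · have := Finset.card_filter_add_card_filter_not (s := X) (fun p => coord a p < t)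
    have h3 : (X.filter fun p => ¬ coord a p < t) = X.filter fun p => t < coord a p := by
      refine Finset.filter_congr fun p hp => ?_
      rw [not_lt]
      exact ⟨fun h => lt_of_le_of_ne h (h1 p hp).symm, le_of_lt⟩
    rw [h3] at this
    simp only [OnSide, if_true]
    omega

/-- The default `0` is never relevant for sets with distinct coordinates. -/
noncomputable def med (a : Bool) (X : Finset CPoint) : ℝ :=
  if h : ∃ t, IsMedian a X t then h.choose else 0

theorem isMedian_med {X : Finset CPoint} {a : Bool} (hX : Set.InjOn (coord a) X) :
    IsMedian a X (med a X) := by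
  have h := exists_isMedian hX
  rw [med, dif_pos h]
  exact h.choose_spec

/-! ### Cells of the four-way subdivision by medians -/

/-- A quadrant: the side of the threshold on each axis. -/
abbrev Quad := Bool → Bool

/-- The head of the word is the most recent split, so the ancestors of a cell are the suffixes of
its word. -/
noncomputable def cell (X : Finset CPoint) : List Quad → Finset CPoint
  | [] => X
  | q :: w => (cell X w).filter fun p => ∀ a, OnSide (q a) (coord a p) (med a (cell X w))

/-- The open region that belongs to a cell. -/
def InCell (X : Finset CPoint) : List Quad → CPoint → Prop
  | [], _ => True
  | q :: w, p => InCell X w p ∧ ∀ a, OnSide (q a) (coord a p) (med a (cell X w))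

theorem inCell_of_mem {X : Finset CPoint} {w : List Quad} {p : CPoint} (h : p ∈ cell X w) :
    InCell X w p := by
  induction w with
  | nil => trivial
  | cons q w ih =>
    rw [cell, Finset.mem_filter] at h
    exact ⟨ih h.1, h.2⟩

theorem cell_anti {X : Finset CPoint} {v w : List Quad} (h : v <:+ w) : cell X w ⊆ cell X v := by
  induction w with
  | nil => rw [List.suffix_nil.1 h]
  | cons q w ih =>
    rcases List.suffix_cons_iff.1 h with rfl | h
    · exact subset_rfl
    · exact (Finset.filter_subset _ _).trans (ih h)

theorem cell_subset (X : Finset CPoint) (w : List Quad) : cell X w ⊆ X :=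
  cell_anti List.nil_suffix

/-- The region of a cell is a product of open intervals. -/
theorem inCell_iff (X : Finset CPoint) (w : List Quad) :
    ∃ U : Bool → Set ℝ, (∀ a, IsOpen (U a) ∧ (U a).OrdConnected) ∧
      ∀ p, InCell X w p ↔ ∀ a, coord a p ∈ U a := by
  induction w with
  | nil => exact ⟨fun _ => Set.univ, fun _ => ⟨isOpen_univ, Set.ordConnected_univ⟩,
      fun p => by simp [InCell]⟩
  | cons q w ih =>
    obtain ⟨U, hU, h⟩ := ih
    refine ⟨fun a => U a ∩ {r | OnSide (q a) r (med a (cell X w))},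
      fun a => ⟨(hU a).1.inter (isOpen_onSide _ _), (hU a).2.inter (ordConnected_onSide _ _)⟩,
      fun p => ?_⟩
    simp only [InCell, h, Set.mem_inter_iff, Set.mem_ofPred_eq, forall_and]

theorem eq_of_mem_cell {X : Finset CPoint} {p : CPoint} {v w : List Quad}
    (hl : v.length = w.length) (hv : p ∈ cell X v) (hw : p ∈ cell X w) : v = w := by
  induction v generalizing w with
  | nil => exact (List.length_eq_zero_iff.1 hl.symm).symm
  | cons q v ih =>
    cases w with
    | nil => simp at hl
    | cons r w =>
      rw [cell, Finset.mem_filter] at hv hw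
      obtain rfl := ih (by simpa using hl) hv.1 hw.1
      rw [funext fun a => (hv.2 a).unique (hw.2 a)]

/-- Cells of equal depth are disjoint, so the longer word, cut down to the length of the shorter,
must coincide with it. Thus the cells form a laminar family. -/
theorem suffix_of_mem_cell {X : Finset CPoint} {p : CPoint} {v w : List Quad}
    (hv : p ∈ cell X v) (hw : p ∈ cell X w) : v <:+ w ∨ w <:+ v := by
  have key : ∀ {v w : List Quad}, p ∈ cell X v → p ∈ cell X w → v.length ≤ w.length → v <:+ w := by
    intro v w hv hw hl
    have h := List.drop_suffix (w.length - v.length) w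
    rwa [← eq_of_mem_cell (p := p) (X := X) (v := v) (by rw [List.length_drop]; omega) hv
      (cell_anti h hw)] at h
  rcases le_total v.length w.length with hl | hl
  · exact Or.inl (key hv hw hl)
  · exact Or.inr (key hw hv hl)

/-- The points of `X` have distinct `x` and distinct `y` coordinates. -/
def CoordInj (X : Finset CPoint) : Prop := ∀ a, Set.InjOn (coord a) (X : Set CPoint)

theorem CoordInj.mono {X Y : Finset CPoint} (h : CoordInj Y) (hXY : X ⊆ Y) : CoordInj X :=
  fun a => (h a).mono (Finset.coe_subset.2 hXY)

theorem NonDegenerate.coordInj {S : Finset CPoint} (h : NonDegenerate S) : CoordInj S := by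
  rintro (_ | _)
  · exact h.2
  · exact h.1

theorem CoordInj.isMedian {X : Finset CPoint} (h : CoordInj X) (a : Bool) (w : List Quad) :
    IsMedian a (cell X w) (med a (cell X w)) :=
  isMedian_med (h.mono (cell_subset X w) a)

theorem CoordInj.exists_quad {X : Finset CPoint} (h : CoordInj X) {w : List Quad} {p : CPoint}
    (hp : p ∈ cell X w) : ∃ q, p ∈ cell X (q :: w) := by
  choose q hq using fun a => exists_onSide ((h.isMedian a w).1 p hp)
  exact ⟨q, Finset.mem_filter.2 ⟨hp, hq⟩⟩

theorem CoordInj.filter_onSide {X : Finset CPoint} (h : CoordInj X) (w : List Quad) (a b : Bool) :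
    ((cell X w).filter fun p => OnSide b (coord a p) (med a (cell X w))) =
      (Finset.univ.filter fun q : Quad => q a = b).biUnion fun q => cell X (q :: w) := by
  ext p
  simp only [Finset.mem_filter, Finset.mem_biUnion, Finset.mem_univ, true_and]
  constructor
  · rintro ⟨hp, hs⟩
    obtain ⟨q, hq⟩ := h.exists_quad hp
    exact ⟨q, ((Finset.mem_filter.1 hq).2 a).unique hs, hq⟩
  · rintro ⟨q, rfl, hq⟩
    exact ⟨(Finset.mem_filter.1 hq).1, (Finset.mem_filter.1 hq).2 a⟩

theorem disjoint_cell_cons {X : Finset CPoint} {w : List Quad} {q r : Quad} (hqr : q ≠ r) :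
    Disjoint (cell X (q :: w)) (cell X (r :: w)) := by
  rw [Finset.disjoint_left]
  intro p hq hr
  have := eq_of_mem_cell (by simp) hq hr
  exact hqr (List.cons.inj this).1

theorem CoordInj.biUnion_cell {X : Finset CPoint} (h : CoordInj X) (w : List Quad) :
    (Finset.univ.biUnion fun q => cell X (q :: w)) = cell X w := by
  ext p
  simp only [Finset.mem_biUnion, Finset.mem_univ, true_and]
  exact ⟨fun ⟨q, hq⟩ => (Finset.mem_filter.1 hq).1, h.exists_quad⟩

theorem CoordInj.sum_card_cell {X : Finset CPoint} (h : CoordInj X) (w : List Quad) :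
    ∑ q, (cell X (q :: w)).card = (cell X w).card := by
  rw [← h.biUnion_cell w, Finset.card_biUnion]
  exact fun q _ r _ hqr => disjoint_cell_cons hqr

theorem CoordInj.half_card_le {X : Finset CPoint} (h : CoordInj X) (w : List Quad) (a b : Bool) :
    (cell X w).card / 2 ≤ ∑ q with q a = b, (cell X (q :: w)).card := by
  refine ((h.isMedian a w).2 b).trans ?_
  rw [h.filter_onSide, Finset.card_biUnion]
  exact fun q _ r _ hqr => disjoint_cell_cons hqr

/-- One axis suffices: the side of the `x`-median opposite to `q` contains at least half of the
points, rounded down, and is disjoint from the child. -/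
theorem CoordInj.card_cell_cons {X : Finset CPoint} (h : CoordInj X) (w : List Quad) (q : Quad) :
    (cell X (q :: w)).card + (cell X w).card / 2 ≤ (cell X w).card := by
  refine (Nat.add_le_add_left (h.half_card_le w true (!q true)) _).trans ?_
  rw [← h.sum_card_cell w, ← Finset.sum_filter_add_sum_filter_not Finset.univ
    (fun r : Quad => r true = q true)]
  refine Nat.add_le_add ?_ (le_of_eq ?_)
  · exact Finset.single_le_sum (f := fun r => (cell X (r :: w)).card) (fun _ _ => Nat.zero_le _)
      (by simp)
  · refine Finset.sum_congr (Finset.filter_congr fun r _ => ?_) fun _ _ => rfl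
    cases r true <;> cases q true <;> simp

end RedBlue

namespace RedBlue
open scoped Classical

/-! ### Sums over the inner nodes of the subdivision -/

/-- Cells that need no further subdivision. -/
def IsLeaf (S Y : Finset CPoint) : Prop := Y.card ≤ 1 ∨ SafeSubset Y S

theorem IsLeaf.mono {S Y Z : Finset CPoint} (h : IsLeaf S Y) (hZ : Z ⊆ Y) : IsLeaf S Z := by
  rcases h with h | ⟨h, B, hB, hs⟩
  · exact Or.inl ((Finset.card_le_card hZ).trans h)
  · exact Or.inr ⟨hZ.trans h, B, (Finset.coe_subset.2 hZ).trans hB, hs⟩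

theorem two_le_card_of_not_isLeaf {S Y : Finset CPoint} (h : ¬ IsLeaf S Y) : 2 ≤ Y.card := by
  by_contra h'
  exact h (Or.inl (by omega))

/-- The sum of `f` over the inner nodes at depth less than `k` below `w`. -/
noncomputable def nodeSum (S X : Finset CPoint) (f : List Quad → ℝ) : ℕ → List Quad → ℝ
  | 0, _ => 0
  | k + 1, w => if IsLeaf S (cell X w) then 0 else f w + ∑ q : Quad, nodeSum S X f k (q :: w)

variable {S X : Finset CPoint}

theorem nodeSum_nonneg {f : List Quad → ℝ} (hf : ∀ w, 0 ≤ f w) (k : ℕ) (w : List Quad) :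
    0 ≤ nodeSum S X f k w := by
  induction k generalizing w with
  | zero => exact le_rfl
  | succ k ih =>
    rw [nodeSum]
    split_ifs
    · exact le_rfl
    · exact add_nonneg (hf w) (Finset.sum_nonneg fun q _ => ih _)

theorem nodeSum_mono {f g : List Quad → ℝ} (h : ∀ w, ¬ IsLeaf S (cell X w) → f w ≤ g w) (k : ℕ)
    (w : List Quad) : nodeSum S X f k w ≤ nodeSum S X g k w := by
  induction k generalizing w with
  | zero => exact le_rfl
  | succ k ih =>
    rw [nodeSum, nodeSum]
    split_ifs with hw
    · exact le_rfl
    · exact add_le_add (h w hw) (Finset.sum_le_sum fun q _ => ih _)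

theorem nodeSum_add (f g : List Quad → ℝ) (k : ℕ) (w : List Quad) :
    nodeSum S X (fun w => f w + g w) k w = nodeSum S X f k w + nodeSum S X g k w := by
  induction k generalizing w with
  | zero => simp [nodeSum]
  | succ k ih =>
    rw [nodeSum, nodeSum, nodeSum]
    split_ifs with hw
    · simp
    · simp only [ih, Finset.sum_add_distrib]
      ring

theorem nodeSum_const_mul (c : ℝ) (f : List Quad → ℝ) (k : ℕ) (w : List Quad) :
    nodeSum S X (fun w => c * f w) k w = c * nodeSum S X f k w := by
  induction k generalizing w with
  | zero => simp [nodeSum]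
  | succ k ih =>
    rw [nodeSum, nodeSum]
    split_ifs with hw
    · simp
    · simp only [ih, ← Finset.mul_sum]
      ring

/-- Changing the summand by at most `d` at a single node changes the sum by at most `d`. -/
theorem nodeSum_le_add {f g : List Quad → ℝ} {v : List Quad} {d : ℝ} (hd : 0 ≤ d)
    (h : ∀ w, w ≠ v → f w ≤ g w) (hv : f v ≤ g v + d) (k : ℕ) (w : List Quad) :
    nodeSum S X f k w ≤ nodeSum S X g k w + if w <:+ v then d else 0 := by
  induction k generalizing w with
  | zero => simp only [nodeSum]; split_ifs <;> simp [hd]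
  | succ k ih =>
    rw [nodeSum, nodeSum]
    by_cases hw : IsLeaf S (cell X w)
    · simp only [if_pos hw]; split_ifs <;> simp [hd]
    simp only [if_neg hw]
    have hsum := Finset.sum_le_sum fun q (_ : q ∈ Finset.univ) => ih (q :: w)
    rw [Finset.sum_add_distrib] at hsum
    have hcons : ∀ q : Quad, q :: w <:+ v → w <:+ v := fun q hq =>
      (List.suffix_cons q w).trans hq
    by_cases hwv : w = v
    · have h0 : ∑ q : Quad, (if q :: w <:+ v then d else 0) = 0 := by
        refine Finset.sum_eq_zero fun q _ => if_neg fun hq => ?_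
        have := hq.length_le
        simp [hwv] at this
      rw [h0] at hsum
      subst hwv
      simp only [List.suffix_rfl, if_true]
      linarith
    · have hf := h w hwv
      by_cases hs : w <:+ v
      · have h1 : ∑ q : Quad, (if q :: w <:+ v then d else 0) ≤ d := by
          by_cases hq : ∃ q, q :: w <:+ v
          · obtain ⟨q, hq⟩ := hq
            rw [Finset.sum_eq_single q]
            · simp [hq]
            · intro r _ hr
              refine if_neg fun hr' => hr ?_
              have := List.suffix_of_suffix_length_le hr' hq (by simp)
              exact (List.cons.inj (this.eq_of_length (by simp))).1
            · simp
          · rw [Finset.sum_eq_zero fun q _ => if_neg fun h => hq ⟨q, h⟩]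
            exact hd
        rw [if_pos hs]
        linarith
      · have h0 : ∑ q : Quad, (if q :: w <:+ v then d else 0) = 0 :=
          Finset.sum_eq_zero fun q _ => if_neg fun hq => hs (hcons q hq)
        rw [if_neg hs]
        linarith

/-- A child has at most half of the points, rounded up, which is at most two thirds as soon as there
are two points; and `0.82 ^ 2 ≥ 2 / 3`. -/
theorem CoordInj.sqrt_card_cell_cons (h : CoordInj X) {w : List Quad}
    (hw : ¬ IsLeaf S (cell X w)) (q : Quad) :
    √((cell X (q :: w)).card : ℝ) ≤ 0.82 * √((cell X w).card : ℝ) := by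
  have h1 := h.card_cell_cons w q
  have h2 := two_le_card_of_not_isLeaf hw
  have h3 : 3 * (cell X (q :: w)).card ≤ 2 * (cell X w).card := by omega
  have h4 : (3 : ℝ) * (cell X (q :: w)).card ≤ 2 * (cell X w).card := by exact_mod_cast h3
  rw [Real.sqrt_le_left (by positivity), mul_pow, Real.sq_sqrt (Nat.cast_nonneg _)]
  have : (0 : ℝ) ≤ (cell X w).card := Nat.cast_nonneg _
  nlinarith

theorem sqrt_natCast_le (n : ℕ) : √(n : ℝ) ≤ n := by
  rw [Real.sqrt_le_left (Nat.cast_nonneg _)]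
  exact_mod_cast Nat.le_self_pow two_ne_zero n

/-- The bound is a potential: the square roots of the children add up to at least `√|cell| / 0.82`,
hence to at least `1.2 * √|cell|`, and five times the excess pays for the node itself. -/
theorem nodeSum_sqrt_le (h : CoordInj X) (k : ℕ) (w : List Quad) :
    nodeSum S X (fun w => √((cell X w).card : ℝ)) k w ≤
      5 * (cell X w).card - 5 * √((cell X w).card : ℝ) := by
  have h0 : ∀ w, 0 ≤ 5 * ((cell X w).card : ℝ) - 5 * √((cell X w).card : ℝ) := fun w => by
    linarith [sqrt_natCast_le (cell X w).card]
  induction k generalizing w with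
  | zero => exact h0 w
  | succ k ih =>
    rw [nodeSum]
    split_ifs with hw
    · exact h0 w
    have hsum := Finset.sum_le_sum fun q (_ : q ∈ Finset.univ) => ih (q :: w)
    rw [Finset.sum_sub_distrib, ← Finset.mul_sum, ← Finset.mul_sum] at hsum
    have hcard : ∑ q, ((cell X (q :: w)).card : ℝ) = (cell X w).card := by
      exact_mod_cast h.sum_card_cell w
    set r := √((cell X w).card : ℝ) with hr
    have hr1 : 1 ≤ r := by
      rw [hr, Real.one_le_sqrt]
      exact_mod_cast (one_le_two.trans (two_le_card_of_not_isLeaf hw))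
    have hmul : r * r ≤ 0.82 * r * ∑ q, √((cell X (q :: w)).card : ℝ) := by
      have hrr : r * r = ∑ q, ((cell X (q :: w)).card : ℝ) := by
        rw [hcard, hr, Real.mul_self_sqrt (Nat.cast_nonneg _)]
      rw [hrr, Finset.mul_sum]
      refine Finset.sum_le_sum fun q _ => ?_
      have h1 := h.sqrt_card_cell_cons hw q
      have h2 := Real.mul_self_sqrt (Nat.cast_nonneg (α := ℝ) (cell X (q :: w)).card)
      have h3 := Real.sqrt_nonneg ((cell X (q :: w)).card : ℝ)
      nlinarith
    have hle : r ≤ 0.82 * ∑ q, √((cell X (q :: w)).card : ℝ) := by nlinarith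
    rw [hcard] at hsum
    linarith

/-- If at most four of the items arriving at each inner node stay there, then the items passing
through the inner nodes make up all but a linear amount of the total size of the inner nodes. -/
theorem nodeSum_card_le (h : CoordInj X) {a e : List Quad → ℝ}
    (hstay : ∀ w, ¬ IsLeaf S (cell X w) → a w ≤ e w + 4)
    (hea : ∀ w, e w ≤ a w)
    (hsum : ∀ w, ∑ q : Quad, a (q :: w) = e w)
    (ha : ∀ w, a w ≤ (cell X w).card) (k : ℕ) (w : List Quad) :
    nodeSum S X (fun w => ((cell X w).card : ℝ)) k w ≤
      nodeSum S X e k w + ((cell X w).card - a w) * (4 * √((cell X w).card : ℝ)) +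
        16 * nodeSum S X (fun w => √((cell X w).card : ℝ)) k w := by
  -- The middle term is the charge carried by items missing on arrival, `4√|cell|` each. An item
  -- missing among those passed on pays one unit to this node; the at most four items that stay
  -- become newly missing and account for `16√|cell|`.
  have h0 : ∀ w, 0 ≤ ((cell X w).card - a w) * (4 * √((cell X w).card : ℝ)) := fun w =>
    mul_nonneg (sub_nonneg.2 (ha w)) (by positivity)
  induction k generalizing w with
  | zero => simpa [nodeSum] using h0 w
  | succ k ih =>
    rw [nodeSum, nodeSum, nodeSum]
    split_ifs with hw
    · simpa using h0 w
    have hs := Finset.sum_le_sum fun q (_ : q ∈ Finset.univ) => ih (q :: w)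
    rw [Finset.sum_add_distrib, Finset.sum_add_distrib, ← Finset.mul_sum] at hs
    set r := √((cell X w).card : ℝ) with hr
    -- This makes `4 * 0.82 * r ≤ 4 * r - 1`, so the charge of a missing item drops by one from a
    -- node to its children.
    have hr1 : 1.4 ≤ r := by
      have h2 : (2 : ℝ) ≤ (cell X w).card := by exact_mod_cast two_le_card_of_not_isLeaf hw
      exact Real.le_sqrt_of_sq_le (by norm_num; linarith)
    have hd : ∑ q : Quad, (((cell X (q :: w)).card : ℝ) - a (q :: w)) *
        (4 * √((cell X (q :: w)).card : ℝ)) ≤ ((cell X w).card - e w) * (4 * r - 1) := by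
      have hcard : ∑ q, ((cell X (q :: w)).card : ℝ) = (cell X w).card := by
        exact_mod_cast h.sum_card_cell w
      rw [← hcard, ← hsum w, ← Finset.sum_sub_distrib, Finset.sum_mul]
      refine Finset.sum_le_sum fun q _ => mul_le_mul_of_nonneg_left ?_ (sub_nonneg.2 (ha _))
      have := h.sqrt_card_cell_cons hw q
      rw [← hr] at this
      linarith
    have h4 := hstay w hw
    have h5 := hea w
    nlinarith

/-! ### Respectful partitions from the subdivision -/

/-- `X` can be split into singletons and safe subsets of `S` with `∑ |A| log |A|` at least `v`. -/
def Splits (S X : Finset CPoint) (v : ℝ) : Prop :=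
  ∃ 𝒜 : Finset (Finset CPoint), (𝒜 : Set (Finset CPoint)).PairwiseDisjoint id ∧ ∅ ∉ 𝒜 ∧
    𝒜.biUnion id = X ∧ (∀ A ∈ 𝒜, A.card = 1 ∨ SafeSubset A S) ∧
    v ≤ ∑ A ∈ 𝒜, (A.card : ℝ) * Real.logb 2 A.card

theorem Splits.mono {v v' : ℝ} (h : Splits S X v) (hv : v' ≤ v) : Splits S X v' := by
  obtain ⟨𝒜, h1, h2, h3, h4, h5⟩ := h
  exact ⟨𝒜, h1, h2, h3, h4, hv.trans h5⟩

theorem splits_empty (S : Finset CPoint) : Splits S ∅ 0 := ⟨∅, by simp⟩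

theorem Splits.union {Y : Finset CPoint} {v v' : ℝ} (h : Splits S X v) (h' : Splits S Y v')
    (hd : Disjoint X Y) : Splits S (X ∪ Y) (v + v') := by
  obtain ⟨𝒜, h1, h2, h3, h4, h5⟩ := h
  obtain ⟨ℬ, k1, k2, k3, k4, k5⟩ := h'
  have hX : ∀ A ∈ 𝒜, A ⊆ X := fun A hA => h3 ▸ Finset.subset_biUnion_of_mem id hA
  have hY : ∀ A ∈ ℬ, A ⊆ Y := fun A hA => k3 ▸ Finset.subset_biUnion_of_mem id hA
  have hAB : Disjoint 𝒜 ℬ := by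
    rw [Finset.disjoint_left]
    intro A hA hB
    refine h2 ?_
    rwa [← Finset.disjoint_self_iff_empty A |>.1 (hd.mono (hX A hA) (hY A hB))]
  refine ⟨𝒜 ∪ ℬ, ?_, by simp [h2, k2], by rw [Finset.union_biUnion, h3, k3], ?_, ?_⟩
  · rw [Finset.coe_union, Set.pairwiseDisjoint_union]
    exact ⟨h1, k1, fun A hA B hB _ => hd.mono (hX A hA) (hY B hB)⟩
  · intro A hA
    rcases Finset.mem_union.1 hA with hA | hA
    · exact h4 A hA
    · exact k4 A hA
  · rw [Finset.sum_union hAB]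
    exact add_le_add h5 k5

theorem Splits.biUnion {ι : Type*} (s : Finset ι) {Y : ι → Finset CPoint} {v : ι → ℝ}
    (h : ∀ i ∈ s, Splits S (Y i) (v i))
    (hd : (s : Set ι).PairwiseDisjoint Y) : Splits S (s.biUnion Y) (∑ i ∈ s, v i) := by
  induction s using Finset.induction_on with
  | empty => simpa using splits_empty S
  | insert i s hi ih =>
    rw [Finset.biUnion_insert, Finset.sum_insert hi]
    rw [Finset.coe_insert, Set.pairwiseDisjoint_insert_of_notMem (by simpa using hi)] at hd
    refine (h i (Finset.mem_insert_self _ _)).union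
      (ih (fun j hj => h j (Finset.mem_insert_of_mem hj)) hd.1) ?_
    rw [Finset.disjoint_biUnion_right]
    exact hd.2

/-- Jensen's inequality for the convex function `t log t` with equal weights. -/
theorem sum_mul_logb_ge {ι : Type*} [Fintype ι] [Nonempty ι] (f : ι → ℝ) (hf : ∀ i, 0 ≤ f i) :
    (∑ i, f i) * Real.logb 2 (∑ i, f i) - (∑ i, f i) * Real.logb 2 (Fintype.card ι) ≤
      ∑ i, f i * Real.logb 2 (f i) := by
  have hK : (0 : ℝ) < Fintype.card ι := by exact_mod_cast Fintype.card_pos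
  rcases (Finset.sum_nonneg fun i (_ : i ∈ Finset.univ) => hf i).eq_or_lt with h0 | h0
  · have := (Finset.sum_eq_zero_iff_of_nonneg fun i _ => hf i).1 h0.symm
    simp only [← h0, zero_mul, sub_zero]
    exact Finset.sum_nonneg fun i hi => by simp [this i hi]
  have hJ := Real.convexOn_mul_log.map_sum_le (t := Finset.univ)
    (w := fun _ : ι => (Fintype.card ι : ℝ)⁻¹) (p := f) (fun _ _ => by positivity)
    (by simp [hK.ne']) (fun i _ => hf i)
  simp only [smul_eq_mul, ← Finset.mul_sum] at hJ
  rw [Real.log_mul (by positivity) h0.ne', Real.log_inv, mul_assoc,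
    mul_le_mul_iff_right₀ (by positivity)] at hJ
  have hl : (0 : ℝ) < Real.log 2 := Real.log_pos one_lt_two
  simp only [Real.logb, ← mul_div_assoc, ← Finset.sum_div, ← sub_div]
  gcongr
  linarith

theorem splits_cell_of_eq_empty {w : List Quad} (h0 : cell X w = ∅) (k : ℕ) :
    Splits S (cell X w) ((cell X w).card * Real.logb 2 (cell X w).card -
      2 * nodeSum S X (fun w => ((cell X w).card : ℝ)) k w) := by
  refine Splits.mono (v := 0) (by rw [h0]; exact splits_empty S) ?_
  have := nodeSum_nonneg (S := S) (X := X) (f := fun w => ((cell X w).card : ℝ))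
    (fun _ => Nat.cast_nonneg _) k w
  rw [h0]
  simpa using this

/-- Splitting into four loses at most `log 4 = 2` bits per point. The depth bound never cuts
anything off, because the cell of an inner node strictly contains each of its children. -/
theorem splits_cell (h : CoordInj X) (k : ℕ) (w : List Quad) (hk : (cell X w).card ≤ k) :
    Splits S (cell X w) ((cell X w).card * Real.logb 2 (cell X w).card -
      2 * nodeSum S X (fun w => ((cell X w).card : ℝ)) k w) := by
  induction k generalizing w with
  | zero => exact splits_cell_of_eq_empty (Finset.card_eq_zero.1 (by omega)) _
  | succ k ih =>
    rcases Finset.eq_empty_or_nonempty (cell X w) with h0 | h0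
    · exact splits_cell_of_eq_empty h0 _
    rw [nodeSum]
    split_ifs with hw
    · refine ⟨{cell X w}, by simp, ?_, by simp, ?_, by simp⟩
      · simpa [eq_comm] using h0.ne_empty
      · have := h0.card_pos
        simp only [Finset.mem_singleton, forall_eq]
        exact hw.imp (fun _ => by omega) id
    · have h2 := two_le_card_of_not_isLeaf hw
      have hch : ∀ q, (cell X (q :: w)).card ≤ k := fun q => by
        have := h.card_cell_cons w q
        omega
      have key := Splits.biUnion (S := S) Finset.univ (fun q _ => ih (q :: w) (hch q))
        (fun q _ r _ hqr => disjoint_cell_cons hqr)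
      rw [h.biUnion_cell] at key
      refine key.mono ?_
      have hJ := sum_mul_logb_ge (fun q : Quad => ((cell X (q :: w)).card : ℝ))
        (fun _ => Nat.cast_nonneg _)
      have hcard : ∑ q, ((cell X (q :: w)).card : ℝ) = (cell X w).card := by
        exact_mod_cast h.sum_card_cell w
      have h4 : Real.logb 2 (Fintype.card Quad) = 2 := by
        rw [show ((Fintype.card Quad : ℕ) : ℝ) = 2 ^ (2 : ℝ) by norm_num [Fintype.card_fun]]
        exact Real.logb_rpow (by norm_num) (by norm_num)
      rw [hcard, h4] at hJ
      rw [Finset.sum_sub_distrib, ← Finset.mul_sum]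
      linarith

/-! ### From splittings to structural entropy -/

theorem entropy_nonneg (P : Finpartition S) : 0 ≤ entropy P := by
  refine Finset.sum_nonneg fun A hA => mul_nonneg (by positivity) ?_
  have h1 : (0 : ℝ) < A.card := by exact_mod_cast (P.nonempty_of_mem_parts hA).card_pos
  refine Real.logb_nonneg one_lt_two ?_
  rw [one_le_div h1]
  exact_mod_cast Finset.card_le_card (P.le hA)

theorem structuralEntropy_le {P : Finpartition S} (hP : Respectful P) :
    structuralEntropy S ≤ entropy P :=
  csInf_le ⟨0, by rintro _ ⟨P, -, rfl⟩; exact entropy_nonneg P⟩ ⟨P, hP, rfl⟩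

/-- The parts have total size `n`, so `n` times the entropy equals `n log n - ∑ |A| log |A|`. -/
theorem Splits.structuralEntropy_le {v : ℝ} (h : Splits S S v) :
    S.card * structuralEntropy S ≤ S.card * Real.logb 2 S.card - v := by
  obtain ⟨𝒜, h1, h2, h3, h4, h5⟩ := h
  let P : Finpartition S :=
    { parts := 𝒜
      supIndep := Finset.supIndep_iff_pairwiseDisjoint.2 h1
      sup_parts := by rw [← Finset.sup_eq_biUnion] at h3; exact h3
      bot_notMem := h2 }
  have hle := RedBlue.structuralEntropy_le (P := P) h4
  rcases S.eq_empty_or_nonempty with h0 | h0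
  · subst h0
    have : ∀ A ∈ 𝒜, (A.card : ℝ) * Real.logb 2 A.card = 0 := fun A hA => by
      have := Finset.subset_empty.1 (P.le hA)
      simp [this]
    rw [Finset.sum_eq_zero this] at h5
    simpa using h5
  have hn : (0 : ℝ) < S.card := by exact_mod_cast h0.card_pos
  refine (mul_le_mul_of_nonneg_left hle hn.le).trans ?_
  have hcard : ∑ A ∈ 𝒜, (A.card : ℝ) = S.card := by
    exact_mod_cast P.sum_card_parts
  have : S.card * entropy P =
      S.card * Real.logb 2 S.card - ∑ A ∈ 𝒜, (A.card : ℝ) * Real.logb 2 A.card := by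
    rw [entropy, Finset.mul_sum]
    rw [show (S.card : ℝ) * Real.logb 2 S.card = (∑ A ∈ 𝒜, (A.card : ℝ)) * Real.logb 2 S.card by
      rw [hcard], Finset.sum_mul, ← Finset.sum_sub_distrib]
    refine Finset.sum_congr rfl fun A hA => ?_
    have hA0 : (0 : ℝ) < A.card := by exact_mod_cast (P.nonempty_of_mem_parts hA).card_pos
    rw [Real.logb_div hn.ne' hA0.ne', ← mul_sub]
    field_simp
  linarith

end RedBlue

namespace RedBlue
open scoped Classical

/-! ### The adversary -/

noncomputable def colorClass (S : Finset CPoint) (c : Color) : Finset CPoint :=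
  S.filter fun p => p.color = c

theorem CoordInj.colorClass {S : Finset CPoint} (h : CoordInj S) (c : Color) :
    CoordInj (colorClass S c) := h.mono (Finset.filter_subset _ _)

/-- What the adversary has committed to: a cell for every index, together with an ordering of `S`
which respects these cells. An index whose cell is a leaf is committed to its point. -/
structure Commitment {n : ℕ} (S : Finset CPoint) (col : Fin n → Color) where
  pos : Fin n → List Quad
  pt : Fin n ≃ {p // p ∈ S}
  mem : ∀ i, (pt i : CPoint) ∈ cell (colorClass S (col i)) (pos i)

namespace Commitment

variable {n : ℕ} {S : Finset CPoint} {col : Fin n → Color}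

/-- The ordering of `S` that belongs to the commitment. -/
def input (s : Commitment S col) (i : Fin n) : CPoint := s.pt i

/-- The cell of the index `i`. -/
noncomputable def cellAt (s : Commitment S col) (i : Fin n) : Finset CPoint :=
  cell (colorClass S (col i)) (s.pos i)

/-- The input `I` agrees with the commitment. -/
def Admits (s : Commitment S col) (I : Fin n → CPoint) : Prop :=
  ∀ i, (I i).color = col i ∧ InCell (colorClass S (col i)) (s.pos i) (I i) ∧
    (IsLeaf S (s.cellAt i) → I i = s.input i)

def Refines (s' s : Commitment S col) : Prop := ∀ I, s'.Admits I → s.Admits I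

theorem color_input (s : Commitment S col) (i : Fin n) : (s.input i).color = col i :=
  (Finset.mem_filter.1 (cell_subset _ _ (s.mem i))).2

theorem admits_input (s : Commitment S col) : s.Admits s.input := fun i =>
  ⟨s.color_input i, inCell_of_mem (s.mem i), fun _ => rfl⟩

/-- The number of indices committed to the cell `w` of colour `c`. -/
noncomputable def arrived (s : Commitment S col) (c : Color) (w : List Quad) : ℕ :=
  (Finset.univ.filter fun i => col i = c ∧ w <:+ s.pos i).card

/-- The number of indices committed to a proper subcell of the cell `w` of colour `c`. -/
noncomputable def passed (s : Commitment S col) (c : Color) (w : List Quad) : ℕ :=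
  (Finset.univ.filter fun i => col i = c ∧ w <:+ s.pos i ∧ s.pos i ≠ w).card

theorem sum_arrived (s : Commitment S col) (c : Color) (w : List Quad) (Q : Finset Quad) :
    ∑ q ∈ Q, s.arrived c (q :: w) =
      (Finset.univ.filter fun i => col i = c ∧ ∃ q ∈ Q, q :: w <:+ s.pos i).card := by
  simp only [arrived]
  rw [← Finset.card_biUnion]
  · congr 1
    ext i
    simp only [Finset.mem_biUnion, Finset.mem_filter, Finset.mem_univ, true_and]
    tauto
  · intro q _ r _ hqr
    rw [Function.onFun, Finset.disjoint_left]
    intro i hi hi'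
    simp only [Finset.mem_filter, Finset.mem_univ, true_and] at hi hi'
    have := (List.suffix_of_suffix_length_le hi.2 hi'.2 (by simp)).eq_of_length (by simp)
    exact hqr (List.cons.inj this).1

theorem exists_cons_suffix_iff {w v : List Quad} :
    (∃ q : Quad, q :: w <:+ v) ↔ w <:+ v ∧ v ≠ w := by
  constructor
  · rintro ⟨q, hq⟩
    refine ⟨(List.suffix_cons q w).trans hq, ?_⟩
    rintro rfl
    simpa using hq.length_le
  · rintro ⟨⟨u, rfl⟩, hne⟩
    rcases List.eq_nil_or_concat u with rfl | ⟨u, q, rfl⟩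
    · simp at hne
    · exact ⟨q, u, by simp⟩

theorem sum_arrived_univ (s : Commitment S col) (c : Color) (w : List Quad) :
    ∑ q : Quad, s.arrived c (q :: w) = s.passed c w := by
  rw [sum_arrived, passed]
  simp only [Finset.mem_univ, true_and, exists_cons_suffix_iff]

theorem arrived_le (s : Commitment S col) (c : Color) (w : List Quad) :
    s.arrived c w ≤ (cell (colorClass S c) w).card := by
  refine Finset.card_le_card_of_injOn s.input ?_ ?_
  · intro i hi
    simp only [Finset.coe_filter, Finset.mem_univ, true_and] at hi
    obtain ⟨rfl, hw⟩ := hi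
    exact cell_anti hw (s.mem i)
  · exact fun i _ j _ h => s.pt.injective (Subtype.ext h)

theorem passed_le_arrived (s : Commitment S col) (c : Color) (w : List Quad) :
    s.passed c w ≤ s.arrived c w :=
  Finset.card_le_card fun i hi => by
    simp only [Finset.mem_filter, Finset.mem_univ, true_and] at hi ⊢
    exact ⟨hi.1, hi.2.1⟩

/-- The number of moves down the subdivision that the algorithm has paid for. -/
noncomputable def paid (s : Commitment S col) : ℝ :=
  nodeSum S (colorClass S Color.red) (fun w =>
    (min (s.passed Color.red w) ((cell (colorClass S Color.red) w).card / 2) : ℕ)) S.card [] +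
  nodeSum S (colorClass S Color.blue) (fun w =>
    (min (s.passed Color.blue w) ((cell (colorClass S Color.blue) w).card / 2) : ℕ)) S.card []

/-! ### Moves of single indices and their price -/

/-- `s'` arises from `s` by moving the index `i` down to the quadrant `q`. -/
structure Moves (s s' : Commitment S col) (i : Fin n) (q : Quad) : Prop where
  pos_eq : s'.pos = Function.update s.pos i (q :: s.pos i)
  input_eq : ∀ j, IsLeaf S (s.cellAt j) → s'.input j = s.input j
  not_leaf : ¬ IsLeaf S (s.cellAt i)

theorem Moves.refines {s s' : Commitment S col} {i : Fin n} {q : Quad} (h : Moves s s' i q) :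
    s'.Refines s := by
  intro I hI j
  obtain ⟨h1, h2, h3⟩ := hI j
  by_cases hj : j = i
  · subst hj
    rw [h.pos_eq, Function.update_self] at h2
    exact ⟨h1, h2.1, fun hl => absurd hl h.not_leaf⟩
  · have hp : s'.pos j = s.pos j := by rw [h.pos_eq, Function.update_of_ne hj]
    rw [hp] at h2
    refine ⟨h1, h2, fun hl => ?_⟩
    rw [← h.input_eq j hl]
    refine h3 ?_
    rwa [cellAt, hp]

/-- A proper suffix of `q :: s.pos i` is a suffix of `s.pos i`, so the only cell newly left behind
is the one that `i` occupied. -/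
theorem Moves.passed_le {s s' : Commitment S col} {i : Fin n} {q : Quad} (h : Moves s s' i q)
    {c : Color} {w : List Quad} (hw : ¬ (c = col i ∧ w = s.pos i)) :
    s'.passed c w ≤ s.passed c w := by
  refine Finset.card_le_card fun j hj => ?_
  simp only [Finset.mem_filter, Finset.mem_univ, true_and, h.pos_eq] at hj ⊢
  by_cases hji : j = i
  · subst hji
    rw [Function.update_self] at hj
    rcases List.suffix_cons_iff.1 hj.2.1 with h' | h'
    · exact absurd h'.symm hj.2.2
    · exact ⟨hj.1, h', fun h => hw ⟨hj.1.symm, h.symm⟩⟩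
  · rwa [Function.update_of_ne hji] at hj

theorem Moves.passed_le_succ {s s' : Commitment S col} {i : Fin n} {q : Quad} (h : Moves s s' i q)
    (c : Color) (w : List Quad) : s'.passed c w ≤ s.passed c w + 1 := by
  refine (Finset.card_le_card fun j hj => ?_).trans (Finset.card_insert_le i _)
  simp only [Finset.mem_filter, Finset.mem_univ, true_and, h.pos_eq, Finset.mem_insert] at hj ⊢
  by_cases hji : j = i
  · exact Or.inl hji
  · rw [Function.update_of_ne hji] at hj
    exact Or.inr hj

theorem Moves.arrived_le {s s' : Commitment S col} {i : Fin n} {q : Quad} (h : Moves s s' i q)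
    {c : Color} {w : List Quad} (hw : w ≠ q :: s.pos i) : s'.arrived c w ≤ s.arrived c w := by
  refine Finset.card_le_card fun j hj => ?_
  simp only [Finset.mem_filter, Finset.mem_univ, true_and, h.pos_eq] at hj ⊢
  by_cases hji : j = i
  · subst hji
    rw [Function.update_self] at hj
    exact ⟨hj.1, (List.suffix_cons_iff.1 hj.2).resolve_left hw⟩
  · rwa [Function.update_of_ne hji] at hj

theorem Moves.paid_le_add {s s' : Commitment S col} {i : Fin n} {q : Quad} (h : Moves s s' i q)
    {d : ℝ} (hd : 0 ≤ d)
    (hi : ((min (s'.passed (col i) (s.pos i)) ((s.cellAt i).card / 2) : ℕ) : ℝ) ≤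
      (min (s.passed (col i) (s.pos i)) ((s.cellAt i).card / 2) : ℕ) + d) :
    s'.paid ≤ s.paid + d := by
  have hsame : ∀ c, c ≠ col i → nodeSum S (colorClass S c) (fun w =>
      ((min (s'.passed c w) ((cell (colorClass S c) w).card / 2) : ℕ) : ℝ)) S.card [] ≤
      nodeSum S (colorClass S c) (fun w =>
      ((min (s.passed c w) ((cell (colorClass S c) w).card / 2) : ℕ) : ℝ)) S.card [] := by
    intro c hc
    refine nodeSum_mono (fun w _ => ?_) _ _
    have := h.passed_le (c := c) (w := w) (fun h => hc h.1)
    exact_mod_cast min_le_min_right _ this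
  have hdiff : nodeSum S (colorClass S (col i)) (fun w =>
      ((min (s'.passed (col i) w) ((cell (colorClass S (col i)) w).card / 2) : ℕ) : ℝ)) S.card [] ≤
      nodeSum S (colorClass S (col i)) (fun w =>
      ((min (s.passed (col i) w) ((cell (colorClass S (col i)) w).card / 2) : ℕ) : ℝ))
        S.card [] + d := by
    have key := nodeSum_le_add (S := S) (X := colorClass S (col i)) (v := s.pos i) (d := d)
      (f := fun w => ((min (s'.passed (col i) w)
        ((cell (colorClass S (col i)) w).card / 2) : ℕ) : ℝ))
      (g := fun w => ((min (s.passed (col i) w)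
        ((cell (colorClass S (col i)) w).card / 2) : ℕ) : ℝ)) hd (fun w hw => ?_) hi S.card []
    · simpa only [List.nil_suffix, if_true] using key
    have := h.passed_le (c := col i) (w := w) (fun h => hw h.2)
    exact_mod_cast min_le_min_right _ this
  unfold paid
  cases hc : col i
  · rw [hc] at hdiff
    linarith [hsame Color.blue (by simp [hc])]
  · rw [hc] at hdiff
    linarith [hsame Color.red (by simp [hc])]

theorem Moves.paid_le_succ {s s' : Commitment S col} {i : Fin n} {q : Quad} (h : Moves s s' i q) :
    s'.paid ≤ s.paid + 1 := by
  refine h.paid_le_add zero_le_one ?_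
  have := h.passed_le_succ (col i) (s.pos i)
  norm_cast
  omega

theorem Moves.paid_le {s s' : Commitment S col} {i : Fin n} {q : Quad} (h : Moves s s' i q)
    (hfull : (s.cellAt i).card / 2 ≤ s.passed (col i) (s.pos i)) : s'.paid ≤ s.paid := by
  have := h.paid_le_add le_rfl (by
    rw [add_zero, min_eq_right hfull]
    exact_mod_cast min_le_right _ _)
  simpa using this

/-- An index can be moved to a quadrant of its cell which still has room. -/
theorem exists_moves (s : Commitment S col) {i : Fin n} {q : Quad}
    (hi : ¬ IsLeaf S (s.cellAt i))
    (hroom : s.arrived (col i) (q :: s.pos i) <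
      (cell (colorClass S (col i)) (q :: s.pos i)).card) :
    ∃ s', Moves s s' i q := by
  -- If every index holding a point of the quadrant were committed to it, the quadrant would be
  -- full. So some `k` holds such a point without being committed there. By laminarity the cell of
  -- `k` contains that of `i`, and the two indices can exchange their points.
  obtain ⟨k, hk, hpos⟩ : ∃ k, s.input k ∈ cell (colorClass S (col i)) (q :: s.pos i) ∧
      ¬ (q :: s.pos i <:+ s.pos k) := by
    by_contra! hcon
    refine hroom.not_ge (Finset.card_le_card_of_surjOn s.input ?_)
    intro p hp
    have hpS := Finset.mem_filter.1 (cell_subset _ _ hp)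
    obtain ⟨k, hk⟩ := s.pt.surjective ⟨p, hpS.1⟩
    have hkp : s.input k = p := by rw [input, hk]
    refine ⟨k, ?_, hkp⟩
    simp only [Finset.coe_filter, Finset.mem_univ, true_and]
    refine ⟨?_, hcon k (hkp.symm ▸ hp)⟩
    rw [← s.color_input k, hkp, hpS.2]
  have hcol : col k = col i := by
    rw [← s.color_input k]
    exact (Finset.mem_filter.1 (cell_subset _ _ hk)).2
  have hmemk := s.mem k
  rw [hcol] at hmemk
  have hsuf : s.pos k <:+ s.pos i := by
    have h1 := (suffix_of_mem_cell hmemk hk).resolve_right hpos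
    rcases List.suffix_cons_iff.1 h1 with h2 | h2
    · exact absurd (h2 ▸ List.suffix_rfl) hpos
    · exact h2
  -- A subset of a leaf is a leaf, so `k` is not yet tied to its point and may give it away.
  have hkleaf : ¬ IsLeaf S (s.cellAt k) := by
    intro h
    refine hi (h.mono ?_)
    rw [cellAt, cellAt, hcol]
    exact cell_anti hsuf
  refine ⟨⟨Function.update s.pos i (q :: s.pos i), (Equiv.swap i k).trans s.pt, fun j => ?_⟩,
    rfl, fun j hj => ?_, hi⟩
  · rw [Equiv.trans_apply]
    by_cases hji : j = i
    · subst hji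
      rw [Equiv.swap_apply_left, Function.update_self]
      exact hk
    · rw [Function.update_of_ne hji]
      by_cases hjk : j = k
      · subst hjk
        rw [Equiv.swap_apply_right, hcol]
        exact cell_anti hsuf (s.mem i)
      · rw [Equiv.swap_apply_of_ne_of_ne hji hjk]
        exact s.mem j
  · have hji : j ≠ i := by rintro rfl; exact hi hj
    have hjk : j ≠ k := by rintro rfl; exact hkleaf hj
    simp only [input, Equiv.trans_apply, Equiv.swap_apply_of_ne_of_ne hji hjk]

/-! ### Answering the queries -/

/-- The index `i` is committed to a point, or there is room for it on the side `b` of its cell. -/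
def Ready (s : Commitment S col) (a b : Bool) (i : Fin n) : Prop :=
  IsLeaf S (s.cellAt i) ∨ ∃ q : Quad, q a = b ∧
    s.arrived (col i) (q :: s.pos i) < (cell (colorClass S (col i)) (q :: s.pos i)).card

/-- A full side contains half of the cell, so at least half of the cell's size has already been
passed on and the cap in `paid` is attained. The index then descends for free to the quadrant of its
present point. -/
theorem exists_moves_of_not_ready (hS : CoordInj S) {s : Commitment S col} {a b : Bool} {i : Fin n}
    (h : ¬ s.Ready a b i) : ∃ s' q, Moves s s' i q ∧ s'.paid ≤ s.paid := by
  rw [Ready, not_or] at h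
  obtain ⟨hl, hq⟩ := h
  push Not at hq
  obtain ⟨q, hmem⟩ := (hS.colorClass (col i)).exists_quad (s.mem i)
  have hm : Moves s ⟨Function.update s.pos i (q :: s.pos i), s.pt, fun j => by
      by_cases hji : j = i
      · subst hji
        rw [Function.update_self]
        exact hmem
      · rw [Function.update_of_ne hji]
        exact s.mem j⟩ i q := ⟨rfl, fun _ _ => rfl, hl⟩
  refine ⟨_, q, hm, hm.paid_le ?_⟩
  refine ((hS.colorClass (col i)).half_card_le (s.pos i) a b).trans ?_
  rw [← s.sum_arrived_univ]
  refine (Finset.sum_le_sum fun q hq' => hq q (Finset.mem_filter.1 hq').2).trans ?_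
  exact Finset.sum_le_sum_of_subset (Finset.filter_subset _ _)

/-- The value with which the coordinate of the index `i` is compared. -/
noncomputable def pivot (s : Commitment S col) (a : Bool) (i : Fin n) : ℝ :=
  if IsLeaf S (s.cellAt i) then coord a (s.input i) else med a (s.cellAt i)

/-- The coordinate of an index that is ready can be fixed relative to the pivot. -/
theorem Ready.exists_refines {s : Commitment S col} {a b : Bool} {i : Fin n}
    (h : s.Ready a b i) :
    ∃ s' : Commitment S col, s'.Refines s ∧ s'.paid ≤ s.paid + 1 ∧
      (∀ I, s'.Admits I → coord a (I i) = s.pivot a i ∧ IsLeaf S (s.cellAt i) ∨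
        OnSide b (coord a (I i)) (s.pivot a i)) ∧
      (∀ j, j ≠ i → s.Ready a (!b) j → s'.Ready a (!b) j) ∧
      (∀ j, j ≠ i → s'.cellAt j = s.cellAt j) ∧
      (∀ j, j ≠ i → s'.pivot a j = s.pivot a j) := by
  by_cases hl : IsLeaf S (s.cellAt i)
  · refine ⟨s, fun _ h => h, by linarith, fun I hI => Or.inl ⟨?_, hl⟩, fun _ _ h => h,
      fun _ _ => rfl, fun _ _ => rfl⟩
    rw [pivot, if_pos hl, (hI i).2.2 hl]
  · obtain ⟨q, hqb, hq⟩ := h.resolve_left hl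
    obtain ⟨s', hm⟩ := s.exists_moves hl hq
    have hpos : ∀ j, j ≠ i → s'.pos j = s.pos j := fun j hj => by
      rw [hm.pos_eq, Function.update_of_ne hj]
    have hcell : ∀ j, j ≠ i → s'.cellAt j = s.cellAt j := fun j hj => by
      rw [cellAt, hpos j hj, cellAt]
    refine ⟨s', hm.refines, hm.paid_le_succ, fun I hI => Or.inr ?_, fun j hj hr => ?_, hcell,
      fun j hj => ?_⟩
    · have h2 := (hI i).2.1
      rw [hm.pos_eq, Function.update_self] at h2
      rw [pivot, if_neg hl, ← hqb]
      exact h2.2 a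
    -- The move fills up a quadrant on side `b` only, so the room on the other side is unaffected,
    -- even if both indices share a cell.
    · rw [Ready, hcell j hj, hpos j hj]
      refine hr.imp id ?_
      rintro ⟨r, hr, hlt⟩
      refine ⟨r, hr, lt_of_le_of_lt (hm.arrived_le ?_) hlt⟩
      intro heq
      rw [(List.cons.inj heq).1, hqb] at hr
      simp at hr
    · rw [pivot, hcell j hj, pivot]
      split_ifs with hlj
      · rw [hm.input_eq j hlj]
      · rfl

theorem isInstance_input (hS : CoordInj S) (s : Commitment S col) : IsInstance s.input := by
  have : ∀ a, Function.Injective fun i => coord a (s.input i) := fun a i j h =>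
    s.pt.injective (Subtype.ext (hS a (s.pt i).2 (s.pt j).2 h))
  exact ⟨this true, this false⟩

/-- All inputs in agreement with `s` give the same order to the indices `i` and `j`. -/
def Decides (s : Commitment S col) (a : Bool) (i j : Fin n) : Prop :=
  (∀ I, s.Admits I → coord a (I i) < coord a (I j)) ∨
    ∀ I, s.Admits I → coord a (I j) < coord a (I i)

/-- Sending `i` below the smaller pivot and `j` above the larger one separates them. If both are
already fixed at their pivots, distinctness of the coordinates gives strictness. -/
theorem exists_decides_of_ready (hS : CoordInj S) {s : Commitment S col} {a : Bool} {i j : Fin n}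
    (hij : i ≠ j) (hi : s.Ready a false i) (hj : s.Ready a true j)
    (hle : s.pivot a i ≤ s.pivot a j) :
    ∃ s' : Commitment S col, s'.Refines s ∧ s'.paid ≤ s.paid + 2 ∧ s'.Decides a i j := by
  obtain ⟨s₁, h1, h2, h3, h4, h5, h6⟩ := hi.exists_refines
  obtain ⟨s₂, k1, k2, k3, -⟩ := (h4 j hij.symm hj).exists_refines
  refine ⟨s₂, fun I hI => h1 I (k1 I hI), by linarith, Or.inl fun I hI => ?_⟩
  have hA := h3 I (k1 I hI)
  have hB := k3 I hI
  rw [h5 j hij.symm, h6 j hij.symm] at hB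
  simp only [OnSide, Bool.not_false, if_true, Bool.false_eq_true, if_false] at hA hB
  rcases hA with ⟨hA, hli⟩ | hA <;> rcases hB with ⟨hB, hlj⟩ | hB
  · refine lt_of_le_of_ne (by rw [hA, hB]; exact hle) ?_
    rw [hA, hB, pivot, pivot, if_pos hli, if_pos hlj]
    intro heq
    exact hij (s.pt.injective (Subtype.ext (hS a (s.pt i).2 (s.pt j).2 heq)))
  all_goals linarith

/-- Free moves are made until the index with the smaller pivot is ready below and the other ready
above. Each strictly shrinks a cell, which gives the induction; only the final two moves are paid
for. -/
theorem exists_decides (hS : CoordInj S) (s : Commitment S col) (a : Bool) {i j : Fin n}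
    (hij : i ≠ j) : ∃ s' : Commitment S col, s'.Refines s ∧ s'.paid ≤ s.paid + 2 ∧ s'.Decides a i j := by
  induction hN : (s.cellAt i).card + (s.cellAt j).card using Nat.strong_induction_on
    generalizing s with
  | _ N ih =>
    have hmove : ∀ b k, k = i ∨ k = j → ¬ s.Ready a b k →
        ∃ s' : Commitment S col, s'.Refines s ∧ s'.paid ≤ s.paid + 2 ∧ s'.Decides a i j := by
      intro b k hk hr
      obtain ⟨s', q, hm, hp⟩ := exists_moves_of_not_ready hS hr
      have hlt : (s'.cellAt k).card < (s.cellAt k).card := by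
        have h1 := (hS.colorClass (col k)).card_cell_cons (s.pos k) q
        have h2 := two_le_card_of_not_isLeaf hm.not_leaf
        rw [cellAt] at h2
        rw [cellAt, cellAt, hm.pos_eq, Function.update_self]
        omega
      have heq : ∀ l, l ≠ k → s'.cellAt l = s.cellAt l := fun l hl => by
        rw [cellAt, cellAt, hm.pos_eq, Function.update_of_ne hl]
      obtain ⟨s'', h1, h2, h3⟩ := ih ((s'.cellAt i).card + (s'.cellAt j).card) (by
        rcases hk with rfl | rfl
        · rw [heq j hij.symm]; omega
        · rw [heq i hij]; omega) s' rfl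
      exact ⟨s'', fun I hI => hm.refines I (h1 I hI), by linarith, h3⟩
    by_cases hle : s.pivot a i ≤ s.pivot a j
    · by_cases h1 : s.Ready a false i
      · by_cases h2 : s.Ready a true j
        · exact exists_decides_of_ready hS hij h1 h2 hle
        · exact hmove true j (Or.inr rfl) h2
      · exact hmove false i (Or.inl rfl) h1
    · by_cases h1 : s.Ready a false j
      · by_cases h2 : s.Ready a true i
        · obtain ⟨s', k1, k2, k3⟩ := exists_decides_of_ready hS hij.symm h1 h2 (le_of_not_ge hle)
          exact ⟨s', k1, k2, k3.symm⟩
        · exact hmove true i (Or.inl rfl) h2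
      · exact hmove false j (Or.inr rfl) h1

theorem exists_answer_compare (hS : CoordInj S) (s : Commitment S col) (a : Bool) (i j : Fin n) :
    ∃ s' : Commitment S col, s'.Refines s ∧ s'.paid ≤ s.paid + 2 ∧
      ((∀ I, s'.Admits I → coord a (I i) < coord a (I j)) ∨
        ∀ I, s'.Admits I → ¬ coord a (I i) < coord a (I j)) := by
  by_cases hij : i = j
  · subst hij
    exact ⟨s, fun _ h => h, by linarith, Or.inr fun _ _ => lt_irrefl _⟩
  · obtain ⟨s', h1, h2, h3⟩ := exists_decides hS s a hij
    exact ⟨s', h1, h2, h3.imp id fun h I hI => (h I hI).le.not_gt⟩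

/-- Every query is answered by a refinement, at a cost proportional to its price. -/
theorem exists_answer (hS : CoordInj S) (s : Commitment S col) (q : Query n) :
    ∃ s' : Commitment S col, s'.Refines s ∧ s'.paid ≤ s.paid + 2 * (q.price 0 : ℕ) ∧
      ((∀ I, s'.Admits I → q.Holds I) ∨ ∀ I, s'.Admits I → ¬ q.Holds I) := by
  cases q with
  | ltX i j => simpa [Query.Holds, Query.price, coord] using exists_answer_compare hS s true i j
  | ltY i j => simpa [Query.Holds, Query.price, coord] using exists_answer_compare hS s false i j
  | isRed i =>
    refine ⟨s, fun _ h => h, by simp [Query.price], ?_⟩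
    by_cases h : col i = Color.red
    · exact Or.inl fun I hI => (hI i).1.trans h
    · exact Or.inr fun I hI h' => h ((hI i).1.symm.trans h')

/-- Playing the adversary against a decision tree leads to a commitment which determines the
output and has been paid for by the running time. -/
theorem exists_final (hS : CoordInj S) {α : Type} {F : Problem n α} (A : DecisionTree n α)
    (s : Commitment S col) (hA : ∀ I, IsInstance I → s.Admits I → A.output I = F I) :
    ∃ s' : Commitment S col, s'.paid ≤ s.paid + 2 * (A.time 0 s'.input : ℕ) ∧ s'.Refines s ∧
      ∃ out, ∀ I, IsInstance I → s'.Admits I → F I = out := by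
  induction A generalizing s with
  | report out =>
    refine ⟨s, ?_, fun _ h => h, out, fun I hI h => ?_⟩
    · have : (0 : ℝ) ≤ (DecisionTree.time 0 s.input (DecisionTree.report out) : ℕ) :=
        Nat.cast_nonneg _
      linarith
    · exact (hA I hI h).symm
  | branch q yes no ihy ihn =>
    obtain ⟨s₁, h1, h2, h3 | h3⟩ := exists_answer hS s q
    · obtain ⟨s', k1, k2, k3⟩ := ihy s₁ fun I hI h => by
        have := hA I hI (h1 I h)
        rwa [DecisionTree.output, if_pos (h3 I h)] at this
      refine ⟨s', ?_, fun I hI => h1 I (k2 I hI), k3⟩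
      -- The final input is admitted by `s₁`, so it takes the branch chosen by the adversary. The
      -- charged time is therefore that of an actual ordering of `S`.
      rw [DecisionTree.time, if_pos (h3 _ (k2 _ s'.admits_input)), Nat.cast_add]
      linarith
    · obtain ⟨s', k1, k2, k3⟩ := ihn s₁ fun I hI h => by
        have := hA I hI (h1 I h)
        rwa [DecisionTree.output, if_neg (h3 I h)] at this
      refine ⟨s', ?_, fun I hI => h1 I (k2 I hI), k3⟩
      rw [DecisionTree.time, if_neg (h3 _ (k2 _ s'.admits_input)), Nat.cast_add]
      linarith

end Commitment
end RedBlue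

namespace RedBlue
open scoped Classical

/-! ### Modifying an input -/

variable {n : ℕ}

theorem mem_pointSet {I : Fin n → CPoint} {p : CPoint} : p ∈ pointSet I ↔ ∃ i, I i = p := by
  simp [pointSet]

theorem not_inSpannedInterior_left (p q : CPoint) : ¬ InSpannedInterior p q p := by
  rintro ⟨h1, h2, -, -⟩
  rcases le_total p.x q.x with h | h
  · rw [min_eq_left h] at h1; exact lt_irrefl _ h1
  · rw [max_eq_left h] at h2; exact lt_irrefl _ h2

theorem IsInstance.update {I : Fin n → CPoint} (hI : IsInstance I) {i : Fin n} {p : CPoint}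
    (hx : ∀ j, j ≠ i → (I j).x ≠ p.x) (hy : ∀ j, j ≠ i → (I j).y ≠ p.y) :
    IsInstance (Function.update I i p) := by
  have key : ∀ f : CPoint → ℝ, (Function.Injective fun j => f (I j)) →
      (∀ j, j ≠ i → f (I j) ≠ f p) → Function.Injective fun j => f (Function.update I i p j) := by
    intro f hf hp j k hjk
    by_cases hj : j = i <;> by_cases hk : k = i <;> simp only [hj, hk, Function.update_self,
      Function.update_of_ne, ne_eq, not_false_eq_true] at hjk ⊢
    · exact absurd hjk.symm (hp k hk)
    · exact absurd hjk (hp j hj)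
    · exact hf hjk
  exact ⟨key CPoint.x hI.1 hx, key CPoint.y hI.2 hy⟩

theorem participates_update {I : Fin n → CPoint} {i j : Fin n} {p : CPoint} (hji : j ≠ i)
    (hc : (I j).color ≠ p.color) (hv : ∀ k, k ≠ i → ¬ InSpannedInterior p (I j) (I k)) :
    Participates (pointSet (Function.update I i p)) (Function.update I i p i) := by
  rw [Function.update_self]
  refine ⟨mem_pointSet.2 ⟨i, Function.update_self _ _ _⟩, I j,
    mem_pointSet.2 ⟨j, Function.update_of_ne hji _ _⟩, hc, fun r hr => ?_⟩
  obtain ⟨k, rfl⟩ := mem_pointSet.1 hr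
  by_cases hk : k = i
  · rw [hk, Function.update_self]
    exact not_inSpannedInterior_left _ _
  · rw [Function.update_of_ne hk]
    exact hv k hk

/-- Next to the vertical line through a point of the other colour, a point participates. -/
theorem exists_participates_near_x {I : Fin n → CPoint} (hI : IsInstance I) {i j : Fin n}
    (hc : (I j).color ≠ (I i).color) {U : Set ℝ} (hU : IsOpen U) (hj : (I j).x ∈ U) :
    ∃ x ∈ U, IsInstance (Function.update I i ⟨x, (I i).y, (I i).color⟩) ∧
      Participates (pointSet (Function.update I i ⟨x, (I i).y, (I i).color⟩))
        (Function.update I i ⟨x, (I i).y, (I i).color⟩ i) := by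
  obtain ⟨x, hxU, hx, hgap⟩ := exists_gap_right (Finset.univ.image fun k => (I k).x) hU hj
  have hgap' : ∀ k, (I k).x ≤ (I j).x ∨ x < (I k).x := fun k => hgap _ (by simp)
  refine ⟨x, hxU, hI.update (fun k _ => ?_) (fun k hk => hI.2.ne hk),
    participates_update (j := j) (by rintro rfl; exact hc rfl) hc fun k _ => ?_⟩
  · rcases hgap' k with h | h
    · exact (h.trans_lt hx).ne
    · exact h.ne'
  · rintro ⟨h1, h2, -, -⟩
    simp only [min_eq_right hx.le, max_eq_left hx.le] at h1 h2
    rcases hgap' k with h | h <;> linarith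

/-- Next to the horizontal line through a point of the other colour, a point participates. -/
theorem exists_participates_near_y {I : Fin n → CPoint} (hI : IsInstance I) {i j : Fin n}
    (hc : (I j).color ≠ (I i).color) {U : Set ℝ} (hU : IsOpen U) (hj : (I j).y ∈ U) :
    ∃ y ∈ U, IsInstance (Function.update I i ⟨(I i).x, y, (I i).color⟩) ∧
      Participates (pointSet (Function.update I i ⟨(I i).x, y, (I i).color⟩))
        (Function.update I i ⟨(I i).x, y, (I i).color⟩ i) := by
  obtain ⟨y, hyU, hy, hgap⟩ := exists_gap_right (Finset.univ.image fun k => (I k).y) hU hj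
  have hgap' : ∀ k, (I k).y ≤ (I j).y ∨ y < (I k).y := fun k => hgap _ (by simp)
  refine ⟨y, hyU, hI.update (fun k hk => hI.1.ne hk) (fun k _ => ?_),
    participates_update (j := j) (by rintro rfl; exact hc rfl) hc fun k _ => ?_⟩
  · rcases hgap' k with h | h
    · exact (h.trans_lt hy).ne
    · exact h.ne'
  · rintro ⟨-, -, h1, h2⟩
    simp only [min_eq_right hy.le, max_eq_left hy.le] at h1 h2
    rcases hgap' k with h | h <;> linarith

/-- If the corner `(x₀, y₀)` sees a point of the other colour in the open quadrant given by the
sides `sx` and `sy`, then a point moved next to the corner participates. -/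
theorem exists_participates_near_corner {I : Fin n → CPoint} (hI : IsInstance I) {i j : Fin n}
    (hc : (I j).color ≠ (I i).color) {U V : Set ℝ} (hU : IsOpen U) (hV : IsOpen V) {x₀ y₀ : ℝ}
    (hx₀ : x₀ ∈ U) (hy₀ : y₀ ∈ V) (sx sy : Bool) (hxj : OnSide sx (I j).x x₀)
    (hyj : OnSide sy (I j).y y₀)
    (hmin : ∀ k, OnSide sx (I k).x x₀ → OnSide sy (I k).y y₀ →
      OnSide (!sx) (I k).x (I j).x → OnSide (!sy) (I k).y (I j).y → False) :
    ∃ x ∈ U, ∃ y ∈ V, IsInstance (Function.update I i ⟨x, y, (I i).color⟩) ∧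
      Participates (pointSet (Function.update I i ⟨x, y, (I i).color⟩))
        (Function.update I i ⟨x, y, (I i).color⟩ i) := by
  -- The new coordinate `t` lies slightly past `a` towards `f j`, so every value strictly between
  -- `t` and `f j` is on side `b` of `a` and nearer than `f j`.
  have gap : ∀ (b : Bool) (f : Fin n → ℝ) {W : Set ℝ} (_ : IsOpen W) {a : ℝ} (_ : a ∈ W),
      OnSide b (f j) a →
      ∃ t ∈ W, OnSide b (f j) t ∧ (∀ k, f k ≠ t) ∧
        (∀ k, min t (f j) < f k → f k < max t (f j) → OnSide b (f k) a ∧ OnSide (!b) (f k) (f j)) := by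
    intro b f W hW a ha hj
    cases b
    · obtain ⟨t, htW, hta, hgap⟩ := exists_gap_left (Finset.univ.image f) hW ha
      have hgap' : ∀ k, a ≤ f k ∨ f k < t := fun k => hgap _ (by simp)
      simp only [OnSide, Bool.false_eq_true, if_false, Bool.not_false, if_true] at hj ⊢
      have hjt : f j < t := (hgap' j).resolve_left hj.not_ge
      refine ⟨t, htW, hjt, fun k => ?_, fun k h1 h2 => ?_⟩
      · rcases hgap' k with h | h
        · exact (hta.trans_le h).ne'
        · exact h.ne
      · rw [min_eq_right hjt.le] at h1
        rw [max_eq_left hjt.le] at h2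
        exact ⟨h2.trans hta, h1⟩
    · obtain ⟨t, htW, hta, hgap⟩ := exists_gap_right (Finset.univ.image f) hW ha
      have hgap' : ∀ k, f k ≤ a ∨ t < f k := fun k => hgap _ (by simp)
      simp only [OnSide, Bool.false_eq_true, if_false, Bool.not_true, if_true] at hj ⊢
      have hjt : t < f j := (hgap' j).resolve_left hj.not_ge
      refine ⟨t, htW, hjt, fun k => ?_, fun k h1 h2 => ?_⟩
      · rcases hgap' k with h | h
        · exact (h.trans_lt hta).ne
        · exact h.ne'
      · rw [min_eq_left hjt.le] at h1
        rw [max_eq_right hjt.le] at h2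
        exact ⟨hta.trans h1, h2⟩
  obtain ⟨x, hxU, -, hxne, hx⟩ := gap sx (fun k => (I k).x) hU hx₀ hxj
  obtain ⟨y, hyV, -, hyne, hy⟩ := gap sy (fun k => (I k).y) hV hy₀ hyj
  refine ⟨x, hxU, y, hyV, hI.update (fun k _ => hxne k) (fun k _ => hyne k),
    participates_update (j := j) (by rintro rfl; exact hc rfl) hc fun k _ => ?_⟩
  rintro ⟨h1, h2, h3, h4⟩
  obtain ⟨k1, k2⟩ := hx k h1 h2
  obtain ⟨k3, k4⟩ := hy k h3 h4
  exact hmin k k1 k3 k2 k4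

/-! ### Surrounding a point -/

/-- Moved values lie within `2 * ε` of `g i`, closer than every other original value; the offsets
are distinct, and nonzero so as to avoid `g i` itself. -/
theorem injective_perturb {g : Fin n → ℝ} (hg : Function.Injective g) {i : Fin n}
    {J : Fin 4 → Fin n} {o : Fin 4 → ℝ} (ho : Function.Injective o) (ho0 : ∀ k, o k ≠ 0)
    (ho2 : ∀ k, |o k| ≤ 2) {ε : ℝ} (hε : 0 < ε) (hgap : ∀ m, m ≠ i → 2 * ε < |g m - g i|)
    {g' : Fin n → ℝ} (hJ : ∀ k, g' (J k) = g i + o k * ε)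
    (hg' : ∀ m, (∀ k, J k ≠ m) → g' m = g m) : Function.Injective g' := by
  have key : ∀ k m, (∀ l, J l ≠ m) → g' (J k) ≠ g' m := by
    intro k m hm heq
    rw [hJ, hg' m hm] at heq
    by_cases hmi : m = i
    · rw [hmi] at heq
      have : o k * ε = 0 := by linarith
      exact (mul_ne_zero (ho0 k) hε.ne') this
    · have h1 := hgap m hmi
      rw [← heq, add_sub_cancel_left, abs_mul, abs_of_pos hε] at h1
      have h2 := ho2 k
      nlinarith
  intro m m' h
  by_cases hm : ∀ k, J k ≠ m <;> by_cases hm' : ∀ k, J k ≠ m'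
  · rw [hg' m hm, hg' m' hm'] at h
    exact hg h
  · push Not at hm'
    obtain ⟨k, rfl⟩ := hm'
    exact absurd h.symm (key k m hm)
  · push Not at hm
    obtain ⟨k, rfl⟩ := hm
    exact absurd h (key k m' hm')
  · push Not at hm hm'
    obtain ⟨k, rfl⟩ := hm
    obtain ⟨k', rfl⟩ := hm'
    rw [hJ, hJ] at h
    have : o k * ε = o k' * ε := by linarith
    rw [ho (mul_right_cancel₀ hε.ne' this)]

theorem exists_small {g : Fin n → ℝ} (hg : Function.Injective g) (i : Fin n) {U : Set ℝ}
    (hU : IsOpen U) (hi : g i ∈ U) (o : Fin 4 → ℝ) :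
    ∀ᶠ ε in nhdsWithin (0 : ℝ) (Set.Ioi 0),
      (∀ m, m ≠ i → 2 * ε < |g m - g i|) ∧ ∀ k, g i + o k * ε ∈ U := by
  refine nhdsWithin_le_nhds (Filter.Eventually.and ?_ ?_)
  · rw [Filter.eventually_all]
    intro m
    by_cases hm : m = i
    · exact Filter.Eventually.of_forall fun _ h => absurd hm h
    · have hpos : 0 < |g m - g i| := abs_pos.2 (sub_ne_zero.2 (hg.ne hm))
      have : Filter.Tendsto (fun ε : ℝ => 2 * ε) (nhds 0) (nhds (2 * 0)) :=
        (continuous_const.mul continuous_id).tendsto 0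
      rw [mul_zero] at this
      exact (this.eventually (Iio_mem_nhds hpos)).mono fun _ h _ => h
  · rw [Filter.eventually_all]
    intro k
    have : Filter.Tendsto (fun ε : ℝ => g i + o k * ε) (nhds 0) (nhds (g i + o k * 0)) :=
      (continuous_const.add (continuous_const.mul continuous_id)).tendsto 0
    rw [mul_zero, add_zero] at this
    exact this.eventually (hU.mem_nhds hi)

/-- Four points of the same colour can be moved so that they hide a fifth one. -/
theorem exists_surrounded {I : Fin n → CPoint} (hI : IsInstance I) {i : Fin n} {J : Fin 4 → Fin n}
    (hJ : Function.Injective J) (hJi : ∀ k, J k ≠ i) (hc : ∀ k, (I (J k)).color = (I i).color)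
    {U V : Set ℝ} (hU : IsOpen U) (hV : IsOpen V) (hx : (I i).x ∈ U) (hy : (I i).y ∈ V) :
    ∃ I' : Fin n → CPoint, IsInstance I' ∧ (∀ m, (I' m).color = (I m).color) ∧
      (∀ m, (∀ k, J k ≠ m) → I' m = I m) ∧ (∀ k, (I' (J k)).x ∈ U ∧ (I' (J k)).y ∈ V) ∧
      ¬ Participates (pointSet I') (I' i) := by
  -- One point is placed in each open quadrant around point `i`; using both 1 and 2 in absolute
  -- value keeps the coordinates distinct. Every point of the other colour is more than `2 * ε` away
  -- in both coordinates, so its box with point `i` contains one of the four in its interior.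
  let ox : Fin 4 → ℝ := ![1, -1, -2, 2]
  let oy : Fin 4 → ℝ := ![1, -1, 2, -2]
  have hox : Function.Injective ox := by
    intro a b h; fin_cases a <;> fin_cases b <;> simp [ox] at h ⊢ <;> norm_num at h
  have hoy : Function.Injective oy := by
    intro a b h; fin_cases a <;> fin_cases b <;> simp [oy] at h ⊢ <;> norm_num at h
  have hox0 : ∀ k, ox k ≠ 0 ∧ |ox k| ≤ 2 := by intro k; fin_cases k <;> simp [ox]
  have hoy0 : ∀ k, oy k ≠ 0 ∧ |oy k| ≤ 2 := by intro k; fin_cases k <;> simp [oy]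
  obtain ⟨ε, ⟨⟨hgx, hUx⟩, hgy, hVy⟩, hε⟩ := ((exists_small hI.1 i hU hx ox).and
    (exists_small hI.2 i hV hy oy)).and self_mem_nhdsWithin |>.exists
  replace hε : 0 < ε := hε
  let I' : Fin n → CPoint := fun m =>
    if h : ∃ k, J k = m then
      ⟨(I i).x + ox h.choose * ε, (I i).y + oy h.choose * ε, (I i).color⟩
    else I m
  have hI'J : ∀ k, I' (J k) = ⟨(I i).x + ox k * ε, (I i).y + oy k * ε, (I i).color⟩ := by
    intro k
    have h : ∃ l, J l = J k := ⟨k, rfl⟩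
    simp only [I', dif_pos h, hJ h.choose_spec]
  have hI' : ∀ m, (∀ k, J k ≠ m) → I' m = I m := by
    intro m hm
    exact dif_neg fun ⟨k, hk⟩ => hm k hk
  have hcol : ∀ m, (I' m).color = (I m).color := by
    intro m
    by_cases hm : ∀ k, J k ≠ m
    · rw [hI' m hm]
    · push Not at hm
      obtain ⟨k, rfl⟩ := hm
      rw [hI'J, hc]
  refine ⟨I', ⟨?_, ?_⟩, hcol, hI', ?_, ?_⟩
  · exact injective_perturb hI.1 hox (fun k => (hox0 k).1) (fun k => (hox0 k).2) hε hgx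
      (fun k => by rw [hI'J]) (fun m hm => by rw [hI' m hm])
  · exact injective_perturb hI.2 hoy (fun k => (hoy0 k).1) (fun k => (hoy0 k).2) hε hgy
      (fun k => by rw [hI'J]) (fun m hm => by rw [hI' m hm])
  · intro k
    rw [hI'J]
    exact ⟨hUx k, hVy k⟩
  · rintro ⟨-, q, hq, hqc, hv⟩
    obtain ⟨m, rfl⟩ := mem_pointSet.1 hq
    rw [hcol, hcol] at hqc
    have hm : ∀ k, J k ≠ m := by rintro k rfl; exact hqc (hc k)
    have hmi : m ≠ i := by rintro rfl; exact hqc rfl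
    rw [hI' m hm, hI' i hJi] at hv
    have hin : ∀ k, ¬ InSpannedInterior (I i) (I m)
        ⟨(I i).x + ox k * ε, (I i).y + oy k * ε, (I i).color⟩ := fun k =>
      hv _ (mem_pointSet.2 ⟨J k, hI'J k⟩)
    have h1 := hgx m hmi
    have h2 := hgy m hmi
    simp only [InSpannedInterior] at hin
    rcases lt_abs.1 h1 with h1 | h1 <;> rcases lt_abs.1 h2 with h2 | h2
    · refine hin 0 ⟨?_, ?_, ?_, ?_⟩ <;> simp only [min_lt_iff, lt_max_iff, ox, oy] <;> simp
      · exact Or.inl hε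
      · right; linarith
      · exact Or.inl hε
      · right; linarith
    · refine hin 3 ⟨?_, ?_, ?_, ?_⟩ <;> simp only [min_lt_iff, lt_max_iff, ox, oy] <;> simp
      · exact Or.inl hε
      · right; linarith
      · right; linarith
      · exact Or.inl hε
    · refine hin 2 ⟨?_, ?_, ?_, ?_⟩ <;> simp only [min_lt_iff, lt_max_iff, ox, oy] <;> simp
      · right; linarith
      · exact Or.inl hε
      · exact Or.inl hε
      · right; linarith
    · refine hin 1 ⟨?_, ?_, ?_, ?_⟩ <;> simp only [min_lt_iff, lt_max_iff, ox, oy] <;> simp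
      · right; linarith
      · exact Or.inl hε
      · right; linarith
      · exact Or.inl hε

end RedBlue

namespace RedBlue
open scoped Classical

/-! ### Commitments which determine the output -/

namespace Commitment

variable {n : ℕ} {S : Finset CPoint} {col : Fin n → Color}

theorem admits_update (s : Commitment S col) {i : Fin n} (hi : ¬ IsLeaf S (s.cellAt i))
    {p : CPoint} (hc : p.color = col i) (hp : InCell (colorClass S (col i)) (s.pos i) p) :
    s.Admits (Function.update s.input i p) := by
  intro j
  by_cases hj : j = i
  · subst hj
    rw [Function.update_self]
    exact ⟨hc, hp, fun h => absurd h hi⟩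
  · rw [Function.update_of_ne hj]
    exact s.admits_input j

theorem exists_index (s : Commitment S col) {p : CPoint} (hp : p ∈ S) : ∃ j, s.input j = p := by
  obtain ⟨j, hj⟩ := s.pt.surjective ⟨p, hp⟩
  exact ⟨j, by rw [input, hj]⟩

/-- An index in a cell which is no leaf participates in some admitted input. -/
theorem exists_participates (hS : CoordInj S) (s : Commitment S col) {i : Fin n}
    (hi : ¬ IsLeaf S (s.cellAt i)) :
    ∃ I, IsInstance I ∧ s.Admits I ∧ Participates (pointSet I) (I i) := by
  obtain ⟨U, hU, hcell⟩ := inCell_iff (colorClass S (col i)) (s.pos i)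
  have hinst := s.isInstance_input hS
  have hci := s.color_input i
  have hY : ∀ p ∈ s.cellAt i, p.x ∈ U true ∧ p.y ∈ U false := fun p hp =>
    ⟨(hcell p).1 (inCell_of_mem hp) true, (hcell p).1 (inCell_of_mem hp) false⟩
  have hin : ∀ x ∈ U true, ∀ y ∈ U false,
      InCell (colorClass S (col i)) (s.pos i) ⟨x, y, (s.input i).color⟩ := by
    intro x hx y hy
    rw [hcell]
    rintro (_ | _)
    · exact hy
    · exact hx
  have hne : (s.cellAt i).Nonempty := ⟨_, s.mem i⟩
  obtain ⟨pW, hpW, hW⟩ := Finset.exists_min_image (s.cellAt i) CPoint.x hne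
  obtain ⟨pE, hpE, hE⟩ := Finset.exists_max_image (s.cellAt i) CPoint.x hne
  obtain ⟨pS, hpS, hSo⟩ := Finset.exists_min_image (s.cellAt i) CPoint.y hne
  obtain ⟨pN, hpN, hN⟩ := Finset.exists_max_image (s.cellAt i) CPoint.y hne
  -- The bounding box of the cell cannot be safe, as the cell would be a leaf. It lies in the region
  -- of the cell, a product of open intervals, so `i` can be moved to any place in the box and
  -- slightly beyond its corners.
  let B : Box := ⟨pW.x, pE.x, pS.y, pN.y, hW pE hpE, hSo pN hpN⟩
  have hnot : ¬ B.SafeOfColor S (col i) := by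
    intro h
    refine hi (Or.inr ⟨(cell_subset _ _).trans (Finset.filter_subset _ _), B, ?_, ?_⟩)
    · exact fun p hp => ⟨⟨hW p hp, hE p hp⟩, hSo p hp, hN p hp⟩
    · cases hc : col i
      · exact Or.inl (hc ▸ h)
      · exact Or.inr (hc ▸ h)
  have hclose : ∀ {x y : ℝ}, x ∈ U true → y ∈ U false →
      IsInstance (Function.update s.input i ⟨x, y, (s.input i).color⟩) →
      Participates (pointSet (Function.update s.input i ⟨x, y, (s.input i).color⟩))
        (Function.update s.input i ⟨x, y, (s.input i).color⟩ i) →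
      ∃ I, IsInstance I ∧ s.Admits I ∧ Participates (pointSet I) (I i) :=
    fun hx hy h1 h2 => ⟨_, h1, s.admits_update hi hci (hin _ hx _ hy), h2⟩
  have hcorner : ∀ {b : CPoint} {x₀ y₀ : ℝ} (sx sy : Bool), b ∈ S → b.color ≠ col i →
      x₀ ∈ U true → y₀ ∈ U false → OnSide sx b.x x₀ → OnSide sy b.y y₀ →
      (∀ r ∈ S, OnSide sx r.x x₀ → OnSide sy r.y y₀ → OnSide (!sx) r.x b.x →
        OnSide (!sy) r.y b.y → False) →
      ∃ I, IsInstance I ∧ s.Admits I ∧ Participates (pointSet I) (I i) := by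
    intro b x₀ y₀ sx sy hb hbc hx₀ hy₀ h1 h2 h3
    obtain ⟨j, rfl⟩ := s.exists_index hb
    obtain ⟨x, hx, y, hy, k1, k2⟩ := exists_participates_near_corner hinst (i := i) (j := j)
      (by rwa [hci]) (hU true).1 (hU false).1 hx₀ hy₀ sx sy h1 h2
      (fun k => h3 _ (s.pt k).2)
    exact hclose hx hy k1 k2
  have hxU := hY _ (s.mem i)
  by_cases hcross : B.CrossSafe S (col i)
  swap
  · simp only [Box.CrossSafe, AllColor] at hcross
    push Not at hcross
    obtain ⟨b, ⟨hbS, hb⟩, hbc⟩ := hcross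
    obtain ⟨j, rfl⟩ := s.exists_index hbS
    -- A point of the other colour in the cross shares its `x` or its `y` with the box; `i` is moved
    -- right next to that line.
    rcases hb with hb | hb
    · obtain ⟨x, hx, h1, h2⟩ := exists_participates_near_x hinst (i := i) (j := j) (by rwa [hci])
        (hU true).1 ((hU true).2.out (hY _ hpW).1 (hY _ hpE).1 hb)
      exact hclose hx hxU.2 h1 h2
    · obtain ⟨y, hy, h1, h2⟩ := exists_participates_near_y hinst (i := i) (j := j) (by rwa [hci])
        (hU false).1 ((hU false).2.out (hY _ hpS).2 (hY _ hpN).2 hb)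
      exact hclose hxU.1 hy h1 h2
  by_cases hne' : AllColor (col i) (neMinimal ((S : Set CPoint) ∩ B.NE))
  swap
  · simp only [AllColor] at hne'
    push Not at hne'
    obtain ⟨b, ⟨⟨hbS, hb⟩, hmin⟩, hbc⟩ := hne'
    refine hcorner true true hbS hbc (hY _ hpE).1 (hY _ hpN).2 hb.1 hb.2 fun r hr h1 h2 h3 h4 => ?_
    exact hmin r ⟨hr, h1, h2⟩ (by rintro rfl; exact lt_irrefl _ h3) ⟨le_of_lt h3, le_of_lt h4⟩
  by_cases hnw : AllColor (col i) (nwMinimal ((S : Set CPoint) ∩ B.NW))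
  swap
  · simp only [AllColor] at hnw
    push Not at hnw
    obtain ⟨b, ⟨⟨hbS, hb⟩, hmin⟩, hbc⟩ := hnw
    refine hcorner false true hbS hbc (hY _ hpW).1 (hY _ hpN).2 hb.1 hb.2 fun r hr h1 h2 h3 h4 => ?_
    exact hmin r ⟨hr, h1, h2⟩ (by rintro rfl; exact lt_irrefl _ h3) ⟨le_of_lt h3, le_of_lt h4⟩
  by_cases hse : AllColor (col i) (seMinimal ((S : Set CPoint) ∩ B.SE))
  swap
  · simp only [AllColor] at hse
    push Not at hse
    obtain ⟨b, ⟨⟨hbS, hb⟩, hmin⟩, hbc⟩ := hse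
    refine hcorner true false hbS hbc (hY _ hpE).1 (hY _ hpS).2 hb.1 hb.2 fun r hr h1 h2 h3 h4 => ?_
    exact hmin r ⟨hr, h1, h2⟩ (by rintro rfl; exact lt_irrefl _ h3) ⟨le_of_lt h3, le_of_lt h4⟩
  by_cases hsw : AllColor (col i) (swMinimal ((S : Set CPoint) ∩ B.SW))
  swap
  · simp only [AllColor] at hsw
    push Not at hsw
    obtain ⟨b, ⟨⟨hbS, hb⟩, hmin⟩, hbc⟩ := hsw
    refine hcorner false false hbS hbc (hY _ hpW).1 (hY _ hpS).2 hb.1 hb.2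
      fun r hr h1 h2 h3 h4 => ?_
    exact hmin r ⟨hr, h1, h2⟩ (by rintro rfl; exact lt_irrefl _ h3) ⟨le_of_lt h3, le_of_lt h4⟩
  exact absurd ⟨hcross, hne', hnw, hse, hsw⟩ hnot

/-- If five indices share a cell which is no leaf, then each of them can be hidden. -/
theorem exists_not_participates (hS : CoordInj S) (s : Commitment S col) {c : Color}
    {w : List Quad} (hw : ¬ IsLeaf S (cell (colorClass S c) w)) {i : Fin n} {J : Fin 4 → Fin n}
    (hJ : Function.Injective J) (hJi : ∀ k, J k ≠ i) (hi : col i = c ∧ s.pos i = w)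
    (hJw : ∀ k, col (J k) = c ∧ s.pos (J k) = w) :
    ∃ I, IsInstance I ∧ s.Admits I ∧ ¬ Participates (pointSet I) (I i) := by
  obtain ⟨U, hU, hcell⟩ := inCell_iff (colorClass S c) w
  have hmem : ∀ a, coord a (s.input i) ∈ U a := by
    have := inCell_of_mem (s.mem i)
    rw [hi.1, hi.2] at this
    exact (hcell _).1 this
  obtain ⟨I, h1, h2, h3, h4, h5⟩ := exists_surrounded (s.isInstance_input hS) hJ hJi
    (fun k => by rw [s.color_input, s.color_input, (hJw k).1, hi.1])
    (hU true).1 (hU false).1 (hmem true) (hmem false)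
  refine ⟨I, h1, fun m => ?_, h5⟩
  by_cases hm : ∀ k, J k ≠ m
  · rw [h3 m hm]
    exact s.admits_input m
  · push Not at hm
    obtain ⟨k, rfl⟩ := hm
    refine ⟨by rw [h2, s.color_input], ?_, fun hl => ?_⟩
    · rw [(hJw k).1, (hJw k).2, hcell]
      rintro (_ | _)
      · exact (h4 k).2
      · exact (h4 k).1
    · rw [cellAt, (hJw k).1, (hJw k).2] at hl
      exact absurd hl hw

/-- If the participating indices are the same on all admitted inputs, then at most four indices
stay at an inner node. -/
theorem arrived_le_passed_add_four (hS : CoordInj S) (s : Commitment S col)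
    (hconst : ∃ P : Finset (Fin n), ∀ I, IsInstance I → s.Admits I →
      ∀ i, i ∈ P ↔ Participates (pointSet I) (I i)) {c : Color} {w : List Quad}
    (hw : ¬ IsLeaf S (cell (colorClass S c) w)) : s.arrived c w ≤ s.passed c w + 4 := by
  obtain ⟨P, hP⟩ := hconst
  set T := Finset.univ.filter fun i => col i = c ∧ s.pos i = w with hT
  have hsub : s.arrived c w ≤ s.passed c w + T.card := by
    refine (Finset.card_le_card fun i hi => ?_).trans (Finset.card_union_le _ _)
    simp only [hT, Finset.mem_union, Finset.mem_filter, Finset.mem_univ, true_and] at hi ⊢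
    tauto
  by_contra hcon
  have hcard : 5 ≤ T.card := by omega
  obtain ⟨i, hi⟩ : T.Nonempty := Finset.card_pos.1 (by omega)
  have hcard' : 4 ≤ (T.erase i).card := by rw [Finset.card_erase_of_mem hi]; omega
  let J := Finset.orderEmbOfCardLe (T.erase i) hcard'
  have hJ : ∀ k, J k ∈ T.erase i := Finset.orderEmbOfCardLe_mem _ hcard'
  have hi' := (Finset.mem_filter.1 hi).2
  obtain ⟨I, h1, h2, h3⟩ := s.exists_not_participates hS hw J.injective
    (fun k => Finset.ne_of_mem_erase (hJ k)) hi'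
    (fun k => (Finset.mem_filter.1 (Finset.mem_of_mem_erase (hJ k))).2)
  obtain ⟨I', k1, k2, k3⟩ := s.exists_participates hS (i := i) (by
    rwa [cellAt, hi'.1, hi'.2])
  exact h3 ((hP I h1 h2 i).1 ((hP I' k1 k2 i).2 k3))

theorem arrived_nil (s : Commitment S col) (c : Color) :
    s.arrived c [] = (colorClass S c).card := by
  refine le_antisymm (s.arrived_le c []) (Finset.card_le_card_of_surjOn s.input fun p hp => ?_)
  have hp' := Finset.mem_filter.1 hp
  obtain ⟨j, rfl⟩ := s.exists_index hp'.1
  exact ⟨j, by simp [← hp'.2, s.color_input], rfl⟩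

/-- The total size of the inner nodes is bounded by the moves paid for. -/
theorem nodeSum_card_le_paid (hS : CoordInj S) (s : Commitment S col)
    (hconst : ∃ P : Finset (Fin n), ∀ I, IsInstance I → s.Admits I →
      ∀ i, i ∈ P ↔ Participates (pointSet I) (I i)) (c : Color) (k : ℕ) :
    nodeSum S (colorClass S c) (fun w => ((cell (colorClass S c) w).card : ℝ)) k [] ≤
      2 * nodeSum S (colorClass S c) (fun w =>
        ((min (s.passed c w) ((cell (colorClass S c) w).card / 2) : ℕ) : ℝ)) k [] +
      85 * (colorClass S c).card := by
  have hX := hS.colorClass c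
  have h1 := nodeSum_card_le (S := S) hX (a := fun w => (s.arrived c w : ℝ))
    (e := fun w => (s.passed c w : ℝ))
    (fun w hw => by exact_mod_cast s.arrived_le_passed_add_four hS hconst hw)
    (fun w => by exact_mod_cast s.passed_le_arrived c w)
    (fun w => by exact_mod_cast s.sum_arrived_univ c w)
    (fun w => by exact_mod_cast s.arrived_le c w) k []
  have h2 := nodeSum_sqrt_le (S := S) hX k []
  have h3 : nodeSum S (colorClass S c) (fun w => (s.passed c w : ℝ)) k [] ≤
      nodeSum S (colorClass S c) (fun w =>
        2 * ((min (s.passed c w) ((cell (colorClass S c) w).card / 2) : ℕ) : ℝ) +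
          √((cell (colorClass S c) w).card : ℝ)) k [] := by
    refine nodeSum_mono (fun w hw => ?_) k []
    have hr : 1 ≤ √((cell (colorClass S c) w).card : ℝ) := by
      rw [Real.one_le_sqrt]
      exact_mod_cast one_le_two.trans (two_le_card_of_not_isLeaf hw)
    -- The additional one makes up for rounding `|cell| / 2` down.
    have hle : s.passed c w ≤
        2 * min (s.passed c w) ((cell (colorClass S c) w).card / 2) + 1 := by
      have := (s.passed_le_arrived c w).trans (s.arrived_le c w)
      omega
    have hle' : (s.passed c w : ℝ) ≤
        2 * ((min (s.passed c w) ((cell (colorClass S c) w).card / 2) : ℕ) : ℝ) + 1 := by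
      exact_mod_cast hle
    linarith
  rw [nodeSum_add, nodeSum_const_mul] at h3
  have h4 : ((cell (colorClass S c) []).card : ℝ) - s.arrived c [] = 0 := by
    rw [s.arrived_nil c, cell, sub_self]
  rw [h4, zero_mul] at h1
  have h5 := Real.sqrt_nonneg ((cell (colorClass S c) []).card : ℝ)
  have h6 : (cell (colorClass S c) []).card = (colorClass S c).card := rfl
  rw [h6] at h2 h5
  -- The constant is `85 = (16 + 1) * 5`: 16 from the staying indices, 1 from rounding, 5 from the
  -- sum of square roots.
  linarith

end Commitment

/-! ### Structural entropy against the subdivisions of both colours -/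

theorem colorClass_union (S : Finset CPoint) :
    colorClass S Color.red ∪ colorClass S Color.blue = S := by
  ext p
  simp only [colorClass, Finset.mem_union, Finset.mem_filter]
  cases p.color <;> simp

theorem disjoint_colorClass (S : Finset CPoint) :
    Disjoint (colorClass S Color.red) (colorClass S Color.blue) := by
  rw [Finset.disjoint_left]
  intro p h1 h2
  simp only [colorClass, Finset.mem_filter] at h1 h2
  exact Color.noConfusion (h1.2.symm.trans h2.2)

theorem card_colorClass_add (S : Finset CPoint) :
    (colorClass S Color.red).card + (colorClass S Color.blue).card = S.card := by
  rw [← Finset.card_union_of_disjoint (disjoint_colorClass S), colorClass_union]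

/-- The two colour classes are partitioned separately; by convexity this first split costs at most
one bit per point. -/
theorem card_mul_structuralEntropy_le {S : Finset CPoint} (hS : CoordInj S) :
    S.card * structuralEntropy S ≤ S.card + 2 *
      (nodeSum S (colorClass S Color.red) (fun w =>
          ((cell (colorClass S Color.red) w).card : ℝ)) S.card [] +
        nodeSum S (colorClass S Color.blue) (fun w =>
          ((cell (colorClass S Color.blue) w).card : ℝ)) S.card []) := by
  have hsplit : ∀ c, Splits S (colorClass S c) _ := fun c =>
    splits_cell (S := S) (hS.colorClass c) S.card []
      (Finset.card_le_card (Finset.filter_subset _ _))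
  have hu := (hsplit Color.red).union (hsplit Color.blue) (disjoint_colorClass S)
  rw [colorClass_union] at hu
  have h1 := hu.structuralEntropy_le
  have hJ := sum_mul_logb_ge (fun b : Bool =>
    ((colorClass S (if b then Color.red else Color.blue)).card : ℝ)) (fun _ => Nat.cast_nonneg _)
  simp only [Fintype.sum_bool, if_true, Bool.false_eq_true, if_false, Fintype.card_bool] at hJ
  have hn : ((colorClass S Color.red).card : ℝ) + (colorClass S Color.blue).card = S.card := by
    exact_mod_cast card_colorClass_add S
  rw [hn, Nat.cast_ofNat, Real.logb_self_eq_one one_lt_two] at hJ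
  simp only [cell] at h1
  linarith

end RedBlue

namespace RedBlue
open scoped Classical

/-! ### Linear lower bounds -/

variable {n : ℕ} {α : Type}

/-- The solution of the problem `F` tells which points participate. -/
structure Detects (F : Problem n α) (m : Finset α → Finset (Fin n)) : Prop where
  -- The factor two is needed for pairs, each of which names two points.
  card_le : ∀ o, (m o).card ≤ 2 * o.card
  mem_iff : ∀ I i, i ∈ m (F I) ↔ Participates (pointSet I) (I i)

theorem detects_participating (n : ℕ) : Detects (participatingProblem n) id :=
  ⟨fun o => by simp only [id]; omega, fun I i => by simp [participatingProblem]⟩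

theorem Visible.symm {S : Finset CPoint} {p q : CPoint} (h : Visible S p q) : Visible S q p := by
  intro r hr hin
  refine h r hr ?_
  rw [InSpannedInterior] at hin ⊢
  rwa [min_comm, max_comm, min_comm q.y, max_comm q.y] at hin

theorem detects_pairs (n : ℕ) :
    Detects (pairsProblem n) fun o => o.image Prod.fst ∪ o.image Prod.snd := by
  refine ⟨fun o => ?_, fun I i => ?_⟩
  · have h1 := Finset.card_union_le (o.image Prod.fst) (o.image Prod.snd)
    have h2 : (o.image Prod.fst).card ≤ o.card := Finset.card_image_le
    have h3 : (o.image Prod.snd).card ≤ o.card := Finset.card_image_le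
    omega
  · simp only [Finset.mem_union, Finset.mem_image, pairsProblem, Finset.mem_filter,
      Finset.mem_univ, true_and, Prod.exists]
    constructor
    · rintro (⟨a, b, ⟨h1, h2, h3⟩, rfl⟩ | ⟨a, b, ⟨h1, h2, h3⟩, rfl⟩)
      · exact ⟨mem_pointSet.2 ⟨_, rfl⟩, I b, mem_pointSet.2 ⟨_, rfl⟩, by simp [h1, h2], h3⟩
      · exact ⟨mem_pointSet.2 ⟨_, rfl⟩, I a, mem_pointSet.2 ⟨_, rfl⟩, by simp [h1, h2], h3.symm⟩
    · rintro ⟨-, q, hq, hc, hv⟩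
      obtain ⟨j, rfl⟩ := mem_pointSet.1 hq
      cases hi : (I i).color <;> cases hj : (I j).color
      · exact absurd (hj.trans hi.symm) hc
      · exact Or.inl ⟨i, j, ⟨hi, hj, hv⟩, rfl⟩
      · exact Or.inr ⟨j, i, ⟨hj, hi, hv.symm⟩, rfl⟩
      · exact absurd (hj.trans hi.symm) hc

namespace DecisionTree

theorem card_output_le_time (κ : ℕ) (A : DecisionTree n α) (I : Fin n → CPoint) :
    (A.output I).card ≤ A.time κ I := by
  induction A with
  | report out => exact le_rfl
  | branch q yes no ihy ihn =>
    rw [output, time]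
    split_ifs
    · exact ihy.trans (Nat.le_add_left _ _)
    · exact ihn.trans (Nat.le_add_left _ _)

theorem time_zero_le (κ : ℕ) (A : DecisionTree n α) (I : Fin n → CPoint) :
    A.time 0 I ≤ A.time κ I := by
  induction A with
  | report out => exact le_rfl
  | branch q yes no ihy ihn =>
    rw [time, time]
    have : q.price 0 ≤ q.price κ := by cases q <;> simp [Query.price]
    split_ifs <;> omega

/-- The output depends only on the colours and on the points which are compared. -/
theorem exists_compared (A : DecisionTree n α) (I : Fin n → CPoint) :
    ∃ T : Finset (Fin n), T.card + 2 * (A.output I).card ≤ 2 * A.time 0 I ∧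
      ∀ J : Fin n → CPoint, (∀ i ∈ T, J i = I i) → (∀ i, (J i).color = (I i).color) →
        A.output J = A.output I := by
  induction A with
  | report out => exact ⟨∅, by simp [output, time], fun _ _ _ => rfl⟩
  | branch q yes no ihy ihn =>
    obtain ⟨Q, hQ, hQ'⟩ : ∃ Q : Finset (Fin n), Q.card ≤ 2 * q.price 0 ∧
        ∀ J : Fin n → CPoint, (∀ i ∈ Q, J i = I i) → (∀ i, (J i).color = (I i).color) →
          (q.Holds J ↔ q.Holds I) := by
      cases q with
      | ltX i j => exact ⟨{i, j}, Finset.card_le_two, fun J h _ => by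
          simp [Query.Holds, h i (by simp), h j (by simp)]⟩
      | ltY i j => exact ⟨{i, j}, Finset.card_le_two, fun J h _ => by
          simp [Query.Holds, h i (by simp), h j (by simp)]⟩
      | isRed i => exact ⟨∅, by simp, fun J _ h => by simp [Query.Holds, h i]⟩
    by_cases h : q.Holds I
    · obtain ⟨T, h1, h2⟩ := ihy
      refine ⟨Q ∪ T, ?_, fun J hJ hc => ?_⟩
      · have := Finset.card_union_le Q T
        simp only [output, time, if_pos h]
        omega
      · have := (hQ' J (fun i hi => hJ i (Finset.mem_union_left _ hi)) hc).2 h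
        simp only [output, if_pos h, if_pos this]
        exact h2 J (fun i hi => hJ i (Finset.mem_union_right _ hi)) hc
    · obtain ⟨T, h1, h2⟩ := ihn
      refine ⟨Q ∪ T, ?_, fun J hJ hc => ?_⟩
      · have := Finset.card_union_le Q T
        simp only [output, time, if_neg h]
        omega
      · have := mt (hQ' J (fun i hi => hJ i (Finset.mem_union_left _ hi)) hc).1 h
        simp only [output, if_neg h, if_neg this]
        exact h2 J (fun i hi => hJ i (Finset.mem_union_right _ hi)) hc

/-- The output depends only on the coordinates and on the colours which are looked up. -/
theorem exists_looked_up (A : DecisionTree n α) (I : Fin n → CPoint) :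
    ∃ T : Finset (Fin n), T.card ≤ A.time 1 I ∧
      ∀ J : Fin n → CPoint, (∀ i, (J i).x = (I i).x) → (∀ i, (J i).y = (I i).y) →
        (∀ i ∈ T, (J i).color = (I i).color) → A.output J = A.output I := by
  induction A with
  | report out => exact ⟨∅, by simp, fun _ _ _ _ => rfl⟩
  | branch q yes no ihy ihn =>
    obtain ⟨Q, hQ, hQ'⟩ : ∃ Q : Finset (Fin n), Q.card ≤ q.price 1 ∧
        ∀ J : Fin n → CPoint, (∀ i, (J i).x = (I i).x) → (∀ i, (J i).y = (I i).y) →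
          (∀ i ∈ Q, (J i).color = (I i).color) → (q.Holds J ↔ q.Holds I) := by
      cases q with
      | ltX i j => exact ⟨∅, by simp, fun J h _ _ => by simp [Query.Holds, h]⟩
      | ltY i j => exact ⟨∅, by simp, fun J _ h _ => by simp [Query.Holds, h]⟩
      | isRed i => exact ⟨{i}, by simp [Query.price], fun J _ _ h => by
          simp [Query.Holds, h i (by simp)]⟩
    by_cases h : q.Holds I
    · obtain ⟨T, h1, h2⟩ := ihy
      refine ⟨Q ∪ T, ?_, fun J hx hy hc => ?_⟩
      · have := Finset.card_union_le Q T
        simp only [time, if_pos h]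
        omega
      · have := (hQ' J hx hy fun i hi => hc i (Finset.mem_union_left _ hi)).2 h
        simp only [output, if_pos h, if_pos this]
        exact h2 J hx hy fun i hi => hc i (Finset.mem_union_right _ hi)
    · obtain ⟨T, h1, h2⟩ := ihn
      refine ⟨Q ∪ T, ?_, fun J hx hy hc => ?_⟩
      · have := Finset.card_union_le Q T
        simp only [time, if_neg h]
        omega
      · have := mt (hQ' J hx hy fun i hi => hc i (Finset.mem_union_left _ hi)).1 h
        simp only [output, if_neg h, if_neg this]
        exact h2 J hx hy fun i hi => hc i (Finset.mem_union_right _ hi)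

end DecisionTree

/-- A point not compared can be moved next to a point of the other colour without changing the run,
so it must already be among those detected by the output. -/
theorem Detects.le_two_mul_time {F : Problem n α} {m : Finset α → Finset (Fin n)}
    (hF : Detects F m) {A : DecisionTree n α} (hA : Correct F A) {I : Fin n → CPoint}
    (hI : IsInstance I) (hbi : ∀ c, ∃ j, (I j).color ≠ c) : n ≤ 2 * A.time 0 I := by
  obtain ⟨T, h1, h2⟩ := A.exists_compared I
  have hcover : (Finset.univ : Finset (Fin n)) ⊆ T ∪ m (A.output I) := by
    intro i _
    by_cases hi : i ∈ T
    · exact Finset.mem_union_left _ hi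
    refine Finset.mem_union_right _ ?_
    obtain ⟨j, hj⟩ := hbi (I i).color
    obtain ⟨x, -, k1, k2⟩ := exists_participates_near_x hI hj isOpen_univ (Set.mem_univ _)
    rw [← h2 (Function.update I i ⟨x, (I i).y, (I i).color⟩), hA _ k1, hF.mem_iff]
    · exact k2
    · intro k hk
      rw [Function.update_of_ne]
      rintro rfl
      exact hi hk
    · intro k
      by_cases hk : k = i
      · rw [hk, Function.update_self]
      · rw [Function.update_of_ne hk]
  have h3 := (Finset.card_le_card hcover).trans (Finset.card_union_le _ _)
  have h4 := hF.card_le (A.output I)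
  rw [Finset.card_univ, Fintype.card_fin] at h3
  omega

/-- In a monochromatic input nothing participates. Flipping a colour that was not looked up leaves
the run unchanged but makes that point participate. -/
theorem Detects.le_time_one {F : Problem n α} {m : Finset α → Finset (Fin n)}
    (hF : Detects F m) {A : DecisionTree n α} (hA : Correct F A) {I : Fin n → CPoint}
    (hI : IsInstance I) (hn : 2 ≤ n) {c : Color} (hc : ∀ i, (I i).color = c) :
    n ≤ A.time 1 I := by
  obtain ⟨T, h1, h2⟩ := A.exists_looked_up I
  suffices hT : T = Finset.univ by
    rw [hT, Finset.card_univ, Fintype.card_fin] at h1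
    exact h1
  rw [Finset.eq_univ_iff_forall]
  intro i
  by_contra hi
  obtain ⟨c', hc'⟩ : ∃ c' : Color, c ≠ c' := by
    cases c
    · exact ⟨Color.blue, by simp⟩
    · exact ⟨Color.red, by simp⟩
  have hne : ((Finset.univ : Finset (Fin n)).erase i).Nonempty := by
    rw [← Finset.card_pos, Finset.card_erase_of_mem (Finset.mem_univ _), Finset.card_univ,
      Fintype.card_fin]
    omega
  -- No point has its `x`-coordinate strictly between those of `i` and its nearest neighbour in `x`,
  -- so these two see each other.
  obtain ⟨j, hj, hmin⟩ := Finset.exists_min_image _ (fun k => |(I k).x - (I i).x|) hne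
  have hji := Finset.ne_of_mem_erase hj
  have hpart := participates_update (I := I) (i := i) (j := j) (p := ⟨(I i).x, (I i).y, c'⟩) hji
    (by rwa [hc]) fun k hk => by
      rintro ⟨k1, k2, -, -⟩
      have h3 := hmin k (Finset.mem_erase.2 ⟨hk, Finset.mem_univ _⟩)
      simp only at k1 k2
      rcases le_total (I i).x (I j).x with h | h
      · rw [min_eq_left h] at k1
        rw [max_eq_right h] at k2
        rw [abs_of_nonneg (by linarith), abs_of_nonneg (by linarith)] at h3
        linarith
      · rw [min_eq_right h] at k1
        rw [max_eq_left h] at k2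
        rw [abs_of_nonpos (by linarith), abs_of_nonpos (by linarith)] at h3
        linarith
  have hinst : IsInstance (Function.update I i ⟨(I i).x, (I i).y, c'⟩) :=
    hI.update (fun k hk => hI.1.ne hk) (fun k hk => hI.2.ne hk)
  have hout := h2 (Function.update I i ⟨(I i).x, (I i).y, c'⟩)
    (fun k => by by_cases hk : k = i <;> simp [hk])
    (fun k => by by_cases hk : k = i <;> simp [hk])
    (fun k hk => by rw [Function.update_of_ne]; rintro rfl; exact hi hk)
  rw [← hF.mem_iff, ← hA _ hinst, hout, hA I hI, hF.mem_iff] at hpart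
  obtain ⟨-, q, hq, hqc, -⟩ := hpart
  obtain ⟨k, rfl⟩ := mem_pointSet.1 hq
  exact hqc ((hc k).trans (hc i).symm)

/-! ### The lower bounds on the worst-case time -/

variable {S : Finset CPoint}

theorem time_le_worstTime (κ : ℕ) (A : DecisionTree S.card α) (σ : Fin S.card ≃ {p // p ∈ S}) :
    A.time κ (fun i => (σ i : CPoint)) ≤ worstTime κ S A :=
  Finset.le_sup (f := fun σ : Fin S.card ≃ {p // p ∈ S} => A.time κ fun i => (σ i : CPoint))
    (Finset.mem_univ σ)

theorem worstTime_zero_le (κ : ℕ) (A : DecisionTree S.card α) :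
    worstTime 0 S A ≤ worstTime κ S A :=
  Finset.sup_le fun σ _ => (A.time_zero_le κ _).trans (time_le_worstTime κ A σ)

namespace Commitment

/-- Nothing but the colours is committed to. -/
noncomputable def initial (σ : Fin n ≃ {p // p ∈ S}) :
    Commitment S fun i => (σ i : CPoint).color where
  pos _ := []
  pt := σ
  mem i := Finset.mem_filter.2 ⟨(σ i).2, rfl⟩

theorem paid_initial (σ : Fin n ≃ {p // p ∈ S}) : (initial σ).paid ≤ 0 := by
  have hp : ∀ c w, (initial σ).passed c w = 0 := by
    intro c w
    rw [passed, Finset.card_eq_zero, Finset.filter_eq_empty_iff]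
    rintro i - ⟨-, h1, h2⟩
    exact h2 (List.suffix_nil.1 h1).symm
  have hz : ∀ X : Finset CPoint, nodeSum S X (fun _ => (0 : ℝ)) S.card [] = 0 := fun X => by
    have := nodeSum_const_mul (S := S) (X := X) 0 (fun _ => 0) S.card []
    simpa using this
  simp only [paid, hp, Nat.zero_min, Nat.cast_zero, hz, add_zero, le_refl]

end Commitment

theorem Bichromatic.exists_color_ne (hb : Bichromatic S) (σ : Fin n ≃ {p // p ∈ S}) (c : Color) :
    ∃ j, (σ j : CPoint).color ≠ c := by
  obtain ⟨⟨p, hp, hpc⟩, q, hq, hqc⟩ := hb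
  cases c
  · exact ⟨σ.symm ⟨q, hq⟩, by simp [hqc]⟩
  · exact ⟨σ.symm ⟨p, hp⟩, by simp [hpc]⟩

theorem Detects.entropy_le_worstTime (hS : NonDegenerate S) (hb : Bichromatic S)
    {F : Problem S.card α} {m : Finset α → Finset (Fin S.card)} (hF : Detects F m)
    {A : DecisionTree S.card α} (hA : Correct F A) :
    S.card * (structuralEntropy S + 1) ≤ 352 * (worstTime 0 S A : ℝ) := by
  have hS' := hS.coordInj
  obtain ⟨s, h1, -, out, h2⟩ := Commitment.exists_final hS' A
    (Commitment.initial S.equivFin.symm) (fun I hI _ => hA I hI)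
  have hconst : ∃ P : Finset (Fin S.card), ∀ I, IsInstance I → s.Admits I →
      ∀ i, i ∈ P ↔ Participates (pointSet I) (I i) :=
    ⟨m out, fun I hI hs i => by rw [← hF.mem_iff, h2 I hI hs]⟩
  have h3 := s.nodeSum_card_le_paid hS' hconst Color.red S.card
  have h4 := s.nodeSum_card_le_paid hS' hconst Color.blue S.card
  have h5 := card_mul_structuralEntropy_le hS'
  have h6 := Commitment.paid_initial (S := S) S.equivFin.symm
  have h7 : ((colorClass S Color.red).card : ℝ) + (colorClass S Color.blue).card = S.card := by
    exact_mod_cast card_colorClass_add S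
  have h8 : (A.time 0 s.input : ℝ) ≤ worstTime 0 S A := by
    exact_mod_cast time_le_worstTime 0 A s.pt
  have h9 : (S.card : ℝ) ≤ 2 * (A.time 0 s.input : ℕ) := by
    exact_mod_cast hF.le_two_mul_time hA (s.isInstance_input hS') (hb.exists_color_ne s.pt)
  rw [Commitment.paid] at h1
  -- With `T` the time, `n * H ≤ n + 2 * (2 * paid + 85 * n)` and `paid ≤ 2 * T` give `n * (H + 1) ≤
  -- 172 * n + 8 * T`; then `n ≤ 2 * T` gives 352.
  linarith

/-! ### Monochromatic sets and the number of visible pairs -/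

theorem exists_forall_color_eq (hb : ¬ Bichromatic S) : ∃ c, ∀ p ∈ S, p.color = c := by
  by_cases h : ∃ p ∈ S, p.color = Color.red
  · refine ⟨Color.red, fun p hp => ?_⟩
    cases hc : p.color
    · rfl
    · exact absurd ⟨h, p, hp, hc⟩ hb
  · refine ⟨Color.blue, fun p hp => ?_⟩
    cases hc : p.color
    · exact absurd ⟨p, hp, hc⟩ h
    · rfl

/-- The bounding box of a monochromatic set is safe, so the partition into a single part is
respectful and has entropy zero. -/
theorem card_mul_structuralEntropy_nonpos {c : Color} (hc : ∀ p ∈ S, p.color = c)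
    (hne : S.Nonempty) : S.card * structuralEntropy S ≤ 0 := by
  obtain ⟨pW, hpW, hW⟩ := Finset.exists_min_image S CPoint.x hne
  obtain ⟨pE, hpE, hE⟩ := Finset.exists_max_image S CPoint.x hne
  obtain ⟨pS, hpS, hSo⟩ := Finset.exists_min_image S CPoint.y hne
  obtain ⟨pN, hpN, hN⟩ := Finset.exists_max_image S CPoint.y hne
  let B : Box := ⟨pW.x, pE.x, pS.y, pN.y, hW pE hpE, hSo pN hpN⟩
  have hB : B.SafeOfColor S c := ⟨fun p hp => hc p hp.1, fun p hp => hc p hp.1.1,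
    fun p hp => hc p hp.1.1, fun p hp => hc p hp.1.1, fun p hp => hc p hp.1.1⟩
  have hsafe : SafeSubset S S := by
    refine ⟨subset_rfl, B, fun p hp => ⟨⟨hW p hp, hE p hp⟩, hSo p hp, hN p hp⟩, ?_⟩
    cases c
    · exact Or.inl hB
    · exact Or.inr hB
  have hsplit : Splits S S (S.card * Real.logb 2 S.card) :=
    ⟨{S}, by simp, by simpa [eq_comm] using hne.ne_empty, by simp, by simp [hsafe], by simp⟩
  linarith [hsplit.structuralEntropy_le]

theorem Detects.entropy_le_worstTime_one (hS : NonDegenerate S) (hn : 2 ≤ S.card)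
    {F : Problem S.card α} {m : Finset α → Finset (Fin S.card)} (hF : Detects F m)
    {A : DecisionTree S.card α} (hA : Correct F A) :
    S.card * (structuralEntropy S + 1) ≤ 352 * (worstTime 1 S A : ℝ) := by
  by_cases hb : Bichromatic S
  · refine (hF.entropy_le_worstTime hS hb hA).trans ?_
    have : (worstTime 0 S A : ℝ) ≤ worstTime 1 S A := by exact_mod_cast worstTime_zero_le 1 A
    linarith
  · obtain ⟨c, hc⟩ := exists_forall_color_eq hb
    have h1 := card_mul_structuralEntropy_nonpos hc (Finset.card_pos.1 (by omega))
    let s := Commitment.initial (S := S) S.equivFin.symm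
    have h2 := hF.le_time_one hA (s.isInstance_input hS.coordInj) hn fun i => hc _ (s.pt i).2
    have h3 : (S.card : ℝ) ≤ worstTime 1 S A := by
      exact_mod_cast h2.trans (time_le_worstTime 1 A s.pt)
    linarith

theorem card_visiblePairs_le_worstTime (hS : NonDegenerate S) (κ : ℕ)
    {A : DecisionTree S.card (Fin S.card × Fin S.card)} (hA : Correct (pairsProblem S.card) A) :
    (visiblePairs S).card ≤ worstTime κ S A := by
  let s := Commitment.initial (S := S) S.equivFin.symm
  refine le_trans ?_ (time_le_worstTime κ A s.pt)
  refine le_trans ?_ (A.card_output_le_time κ s.input)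
  rw [hA _ (s.isInstance_input hS.coordInj)]
  have hset : pointSet s.input = S := by
    ext p
    rw [mem_pointSet]
    exact ⟨by rintro ⟨i, rfl⟩; exact (s.pt i).2, s.exists_index⟩
  refine Finset.card_le_card_of_surjOn (Prod.map s.input s.input) ?_
  rintro ⟨p, q⟩ hpq
  simp only [visiblePairs, Finset.coe_filter, Finset.mem_product] at hpq
  obtain ⟨⟨hp, hq⟩, h1, h2, h3⟩ := hpq
  obtain ⟨i, rfl⟩ := s.exists_index hp
  obtain ⟨j, rfl⟩ := s.exists_index hq
  refine ⟨(i, j), ?_, rfl⟩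
  simp only [pairsProblem, Finset.coe_filter, Finset.mem_univ, true_and, hset]
  exact ⟨h1, h2, h3⟩

theorem exists_OPT_eq (κ : ℕ) {F : Problem S.card α}
    (hF : ∃ A : DecisionTree S.card α, Correct F A) :
    ∃ A : DecisionTree S.card α, Correct F A ∧ OPT κ S F = worstTime κ S A := by
  obtain ⟨A, hA⟩ := hF
  exact Nat.sInf_mem (s := {t : ℕ | ∃ A : DecisionTree S.card α, Correct F A ∧
    t = worstTime κ S A}) ⟨_, A, hA, rfl⟩

end RedBlue

open RedBlue in
theorem mainTheorem2 :
    -- Reporting participating points.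
    (∃ c : ℝ, 0 < c ∧ ∀ S : Finset CPoint, NonDegenerate S →
      -- Colours are known in advance, i.e. looking up a colour is free.
      (Bichromatic S →
        c * (S.card * (structuralEntropy S + 1)) ≤ (optParticipating 0 S : ℝ)) ∧
      -- Looking up a colour has unit cost.
      (2 ≤ S.card →
        c * (S.card * (structuralEntropy S + 1)) ≤ (optParticipating 1 S : ℝ))) ∧
    -- Reporting red-blue pairs of visible points.
    (∃ c : ℝ, 0 < c ∧ ∀ S : Finset CPoint, NonDegenerate S →
      (Bichromatic S →
        c * (S.card * (structuralEntropy S + 1) + (visiblePairs S).card)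
          ≤ (optPairs 0 S : ℝ)) ∧
      (2 ≤ S.card →
        c * (S.card * (structuralEntropy S + 1) + (visiblePairs S).card)
          ≤ (optPairs 1 S : ℝ))) := by
  refine ⟨⟨1 / 352, by norm_num, fun S hS => ⟨fun hb => ?_, fun hn => ?_⟩⟩,
    ⟨1 / 353, by norm_num, fun S hS => ⟨fun hb => ?_, fun hn => ?_⟩⟩⟩
  · obtain ⟨A, hA, hopt⟩ := exists_OPT_eq 0 (exists_correct_participating S.card)
    have := (detects_participating S.card).entropy_le_worstTime hS hb hA
    rw [optParticipating, hopt]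
    linarith
  · obtain ⟨A, hA, hopt⟩ := exists_OPT_eq 1 (exists_correct_participating S.card)
    have := (detects_participating S.card).entropy_le_worstTime_one hS hn hA
    rw [optParticipating, hopt]
    linarith
  · obtain ⟨A, hA, hopt⟩ := exists_OPT_eq 0 (exists_correct_pairs S.card)
    have h1 := (detects_pairs S.card).entropy_le_worstTime hS hb hA
    have h2 : ((visiblePairs S).card : ℝ) ≤ worstTime 0 S A := by
      exact_mod_cast card_visiblePairs_le_worstTime hS 0 hA
    rw [optPairs, hopt]
    linarith
  · obtain ⟨A, hA, hopt⟩ := exists_OPT_eq 1 (exists_correct_pairs S.card)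
    have h1 := (detects_pairs S.card).entropy_le_worstTime_one hS hn hA
    have h2 : ((visiblePairs S).card : ℝ) ≤ worstTime 1 S A := by
      exact_mod_cast card_visiblePairs_le_worstTime hS 1 hA
    rw [optPairs, hopt]
    linarith
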